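/- **Model.** A similarity graph $G$ is fixed in advance. Its nodes are inserted into a database, each together with its edges to the nodes already stored. A deletion is soft: the node is only marked and stays in the database (also for later insertions) until it is purged. The sequence of updates is chosen independently of the random choices of the algorithm (it may be fixed, or random, e.g. with uniformly random deletions). Time is the number of database operations: degree queries, queries for a uniformly random neighbor, and adjacency queries. A neighborhood $N(v)$ is scanned by repeating random-neighbor queries until $d(v)$ distinct neighbors have been seen. Write $N[v]=N(v)\cup\{v\}$, let $n$ be the current number of nodes in the database, and let $L=\lambda\log n$. **Data.** Each node $u$ has a rank $\pi(u)$, uniform in $[0,1]$ and independent of all others, and possibly a node $p(u)$; $v$ is a pivot if $p(v)=v$; $B_v=\{z: p(z)=v\}$; the algorithm keeps a set $C_v$, the cluster of a pivot $v$ is $C_v\cap B_v$, and all other nodes are singletons. *Explore$(v)$*, for a pivot $v$: scan $N(v)$; for all $w\in N[v]$ such that $p(w)$ is undefined or $\pi(p(w))>\pi(v)$: if $w$ is a pivot, then for each $z\in B_w$ query whether $z\in N(v)$ and, if so, set $p(z)=v$; then set $p(w)=v$. *Estimate* for $C\subseteq B$ (cost of making $C$ one cluster and $B\setminus C$ singletons):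 query the degrees in $C$; query $\lceil 5|C|\log n/\varepsilon^3\rceil$ random pairs of distinct nodes of $C$ for adjacency, and let $Y$ be the resulting estimate of the number of non-edges in $C$; for each $w\in B\setminus C$, query $d(w)$ and $\eta=\lceil 10\log n/\varepsilon^3\rceil$ random neighbors, and let $Z_S(w)$ be $d(w)/\eta$ times the number of them in $S$. The estimate is $\bigl(\sum_{w\in C}d(w)-2\binom{|C|}{2}+3Y+\sum_{w\in B\setminus C}(\tfrac12 Z_{B\setminus C}(w)+Z_{V\setminus B}(w))+9\varepsilon|C|\bigr)/(1-37\varepsilon)$. *Break-cluster$(B_v)$*: let $C_t=\{u\in B_v: d(u)\ge t\}$ and start with $C_v=B_v$ ($t=0$); for $t=1,1+\varepsilon,\dots,(1+\varepsilon)^{\lceil\log_{1+\varepsilon}n\rceil}$ in turn, estimate the costs for $C_t$ and for $C_v$, and replace $C_v$ by $C_t$ if its estimate is smaller. The sets $B_v$, $C_t$, the estimates and the sampled pairs are stored. *Update-cluster$(u,B_v)$*, for a node $u$ that is not in the stored $B_v$: add $u$ to the stored $B_v$. For each stored threshold $t$, add $d(u)$ to the degree part of the estimate; if $d(u)\ge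 t$, moreover replace each stored pair independently with probability $2/(|C_t|+1)$ by $\{u,w\}$ with $w\in C_t$ uniformly random, add $u$ to $C_t$, and sample $\lceil 5\log n/\varepsilon^3\rceil$ further pairs of the new $C_t$ (all new pairs are queried for adjacency). Then $C_v$ is chosen again by successive comparison of the stored estimates. *Insertion of $u$*. If $\pi(u)\,d(u)\le L$: scan $N(u)$ and let $v$ be the node of smallest rank in $N[u]$. If $v=u$, set $p(u)=u$, run Explore$(u)$ and Break-cluster$(B_u)$. If $v\ne u$ is a pivot, set $p(u)=v$, run Update-cluster$(u,B_v)$, and if $\pi(u)\,d(v)\le L$ run Explore$(v)$. If $v\neq u$ is not a pivot, set $p(u)=v$, so that $u$ is a singleton. If $\pi(u)\,d(u)>L$: draw $\lceil\sigma\log n\rceil$ independent uniform samples $s\in N[u]$ and let $v$ be the node of smallest rank among those $p(s)$ that are adjacent to $u$ (adjacency queries). If $v$ exists and $\pi(v)<\pi(u)$, set $p(u)=v$ and run Update-cluster$(u,B_v)$; otherwise $u$ becomes a singleton without pivot, unless it has already been assigned to another node. *Recomputation*. Let $n_0$ be the number of nodes just after the last recomputation ($0$ at the start). As soon as at least $\varepsilon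 n_0/6$ updates have been made since then, purge the soft-deleted nodes, draw new ranks, discard all stored data, set $p(x)=x$ for all nodes, and process all nodes with the insertion procedure in the order of increasing rank. **Theorem.** For every $a\in\mathbb N$ there is $k\in\mathbb N$ such that for all $A,c\in\mathbb R$ there is $K>0$ with the following property. Let $0<\varepsilon<1$ and $0\le\lambda,\sigma\le A\,\varepsilon^{-a}$. For every graph and every sequence of $T\ge 2$ updates as above, starting from the empty database, with probability at least $1-T^{-c}$ the total number of database operations used by the algorithm for all $T$ updates, recomputations included, is at most $T\cdot K\left(\frac{\log T}{\varepsilon}\right)^{k}$, i.e. the amortized time per update is $\mathrm{poly}(\log T,1/\varepsilon)$. -/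

import Mathlib

open MeasureTheory
open scoped ENNReal

noncomputable section

namespace SparsePivot

/-! ## The database model and randomized computations with a query budget -/

/-- The database: a similarity graph, fixed in advance, and the finite set of nodes that are
currently stored (soft-deleted nodes stay in this set until they are purged). The current graph is
the subgraph of `graph` induced on `nodes`. -/
structure Database where
  graph : SimpleGraph ℕ
  nodes : Finset ℕ

open Classical in
/-- The open neighbourhood `N(v)` in the current graph. -/
def Database.nbrs (db : Database) (v : ℕ) : Finset ℕ :=
  db.nodes.filter fun w => v ∈ db.nodes ∧ db.graph.Adj v w

/-- A randomized computation that may access the database. Given the database and the number of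
database operations that it is still allowed to perform, it yields the law of its outcome:
`some (a, b)` if it ends with result `a` and `b` unused operations, and `none` if it needs more
operations than allowed. Thus `m db b none` is the probability that `m` performs more than `b`
database operations. -/
def DBM (α : Type) : Type := Database → ℕ → PMF (Option (α × ℕ))

instance : Monad DBM where
  pure a := fun _ b => PMF.pure (some (a, b))
  bind m k := fun db b => (m db b).bind fun r =>
    match r with
    | none => PMF.pure none
    | some (a, b') => k a db b'

/-- Pay for one database operation. -/
def tick : DBM Unit := fun _ b =>
  match b with
  | 0 => PMF.pure none
  | b' + 1 => PMF.pure (some ((), b'))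

/-- Look into the database, free of charge; used only to define the three database operations. -/
def look {α : Type} (f : Database → α) : DBM α := fun db b => PMF.pure (some (f db, b))

open Classical in
/-- Private coins, free of charge: a uniformly random element of `s` (`dflt` if `s` is empty). -/
def choose (s : Finset ℕ) (dflt : ℕ) : DBM ℕ := fun _ b =>
  if h : s.Nonempty then (PMF.uniformOfFinset s h).map fun x => some (x, b)
  else PMF.pure (some (dflt, b))

/-- Database operation: the degree of `v`. -/
def degree (v : ℕ) : DBM ℕ := do
  tick
  look fun db => (db.nbrs v).card

/-- Database operation: a uniformly random neighbour of `v` (`v` itself if it has none). -/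
def randomNeighbor (v : ℕ) : DBM ℕ := do
  tick
  let s ← look fun db => db.nbrs v
  choose s v

open Classical in
/-- Database operation: are `v` and `w` adjacent? -/
def adjacent (v w : ℕ) : DBM Bool := do
  tick
  look fun db => decide (w ∈ db.nbrs v)

/-- Run a computation on the given database. -/
def onDatabase {α : Type} (db : Database) (m : DBM α) : DBM α := fun _ b => m db b

/-- Apply `f` to the elements of a list, one after the other. -/
def forEach {α β : Type} (f : α → DBM β) : List α → DBM (List β)
  | [] => pure []
  | x :: xs => do
    let y ← f x
    let ys ← forEach f xs
    pure (y :: ys)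

/-- Run `m` independently `k` times. -/
def times {α : Type} (m : DBM α) (k : ℕ) : DBM (List α) := forEach (fun _ => m) (List.range k)

/-- Random-neighbour queries at `v` are repeated until `d` distinct neighbours have been seen.
Each query uses up one unit of the budget, on which the definition recurses. -/
def collect (v d : ℕ) (db : Database) : ℕ → Finset ℕ → PMF (Option (Finset ℕ × ℕ))
  | 0, seen => if d ≤ seen.card then PMF.pure (some (seen, 0)) else PMF.pure none
  | b + 1, seen =>
    if d ≤ seen.card then PMF.pure (some (seen, b + 1))
    else (randomNeighbor v db 1).bind fun r =>
      match r with
      | none => PMF.pure none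
      | some (w, _) => collect v d db b (insert w seen)

/-- Scan the whole neighbourhood `N(v)` with the operations that the database offers. -/
def scan (v : ℕ) : DBM (Finset ℕ) := do
  let d ← degree v
  fun db b => collect v d db b ∅

/-! ## The data that the algorithm maintains -/

/-- Parameters: the accuracy `eps`, and the constants of `L = lam * log n` and of the number
`⌈sig * log n⌉` of sampled neighbours. -/
structure Params where
  eps : ℝ
  lam : ℝ
  sig : ℝ

/-- The threshold `L` when the graph has `n` nodes. -/
def Params.L (P : Params) (n : ℕ) : ℝ := P.lam * Real.log n

/-- The data stored for one candidate `C_t ⊆ B_v`: the threshold `t`, the set `C_t`, the sampled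
pairs of nodes of `C_t` together with the information whether they are non-edges, and the part
of the cost estimate that depends on degrees and on the nodes of `B_v \ C_t`. -/
structure Entry where
  thr : ℝ
  mem : Finset ℕ
  samples : List (ℕ × ℕ × Bool)
  rest : ℝ

/-- The estimated number of non-edges inside the candidate. -/
def Entry.inCluster (e : Entry) : ℝ :=
  ((e.samples.filter fun s => s.2.2).length : ℝ) * (e.mem.card.choose 2 : ℝ) / e.samples.length

/-- The estimate of the cost of clustering `B` into the cluster `C` and singletons. -/
def Entry.estimate (P : Params) (e : Entry) : ℝ :=
  (e.rest - 2 * (e.mem.card.choose 2 : ℝ) + 3 * e.inCluster + 9 * P.eps * e.mem.card) /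
    (1 - 37 * P.eps)

/-- What is stored for a pivot `v`: the set `B_v` which the estimates account for, and one entry
for each threshold. -/
structure Store where
  base : Finset ℕ
  entries : List Entry

/-- The state: the pivot vector `p`, and for each pivot `v` the set `C_v` and the stored estimates.
A node `v` is a pivot if `p(v) = v`. The cluster of a pivot `v` consists of the nodes
`z ∈ C_v` with `p(z) = v`; every node outside these clusters is a singleton, in particular each
`z` whose `p(z)` is not a pivot. -/
structure State where
  pivot : ℕ → Option ℕ
  clus : ℕ → Finset ℕ
  store : ℕ → Store

def State.IsPivot (st : State) (v : ℕ) : Prop := st.pivot v = some v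

open Classical in
/-- `B_v`: the nodes `z` with `p(z) = v`. -/
def State.assigned (st : State) (nodes : Finset ℕ) (v : ℕ) : Finset ℕ :=
  nodes.filter fun z => st.pivot z = some v

def State.setPivot (st : State) (z : ℕ) (v : Option ℕ) : State :=
  { st with pivot := Function.update st.pivot z v }

open Classical in
/-- The clustering that the state represents: the pivot of the cluster of `z`, or `none` if `z` is
a singleton. -/
def State.label (st : State) (z : ℕ) : Option ℕ :=
  (st.pivot z).bind fun v => if st.IsPivot v ∧ z ∈ st.clus v then some v else none

/-! ## Cost estimates -/

/-- Two distinct uniformly random nodes of `C`, and whether they form a non-edge. -/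
def samplePair (C : Finset ℕ) : DBM (ℕ × ℕ × Bool) := do
  let a ← choose C 0
  let b ← choose (C.erase a) 0
  let e ← adjacent a b
  pure (a, b, !e)

/-- `k` sampled pairs (none if `C` has no pair of distinct nodes). -/
def samplePairs (C : Finset ℕ) (k : ℕ) : DBM (List (ℕ × ℕ × Bool)) :=
  if 2 ≤ C.card then times (samplePair C) k else pure []

/-- The estimated contribution of a node `w ∈ B \ C`, from `eta` random incident edges: an edge to
`B \ C` has weight `1/2`, an edge that leaves `B` has weight `1`. -/
def singletonCost (B C : Finset ℕ) (eta : ℕ) (w : ℕ) : DBM ℝ := do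
  let d ← degree w
  let xs ← times (randomNeighbor w) eta
  let zIn : ℝ := (d : ℝ) / eta * (xs.filter fun x => x ∈ B \ C).length
  let zOut : ℝ := (d : ℝ) / eta * (xs.filter fun x => x ∉ B).length
  pure (zIn / 2 + zOut)

/-- The static cost estimate for `C ⊆ B`, `C` being the candidate for the threshold `t`. -/
def costEstimate (P : Params) (n : ℕ) (B C : Finset ℕ) (t : ℝ) : DBM Entry := do
  let ds ← forEach degree C.toList
  let smp ← samplePairs C ⌈5 * (C.card : ℝ) * Real.log n / P.eps ^ 3⌉₊
  let zs ← forEach (singletonCost B C ⌈10 * Real.log n / P.eps ^ 3⌉₊) (B \ C).toList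
  pure ⟨t, C, smp, (ds.sum : ℝ) + zs.sum⟩

/-- The thresholds `1, 1 + ε, (1 + ε)², …` up to the first one that is at least `n`. -/
def thresholds (P : Params) (n : ℕ) : List ℝ :=
  (List.range (⌈Real.log n / Real.log (1 + P.eps)⌉₊ + 1)).map fun i => (1 + P.eps) ^ i

/-- Break-cluster: starting from `C_v = B_v` (threshold `0`), each candidate `C_t` is compared with
the current `C_v`, the costs of both being estimated. Returns `C_v` and what is stored. -/
def breakCluster (P : Params) (n : ℕ) (B : Finset ℕ) : DBM (Finset ℕ × Store) := do
  let ds ← forEach (fun w => do let d ← degree w; pure (w, d)) B.toList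
  let e₀ ← costEstimate P n B B 0
  let r ← (thresholds P n).foldlM (fun (r : Finset ℕ × List Entry) (t : ℝ) => do
      let C := ((ds.filter fun x => decide (t ≤ (x.2 : ℝ))).map Prod.fst).toFinset
      let e ← costEstimate P n B C t
      let e' ← costEstimate P n B r.1 0
      pure (if e.estimate P < e'.estimate P then C else r.1, r.2 ++ [e])) (B, [e₀])
  pure (r.1, ⟨B, r.2⟩)

/-- When `u` joins a candidate with node set `C`, each old sample is kept with probability
`|C|(|C|-1) / (|C|(|C|+1))`, and otherwise (probability `2 / (|C|+1)`) replaced by `{u, w}` with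
a uniformly random `w ∈ C`. -/
def resample (C : Finset ℕ) (u : ℕ) (s : ℕ × ℕ × Bool) : DBM (ℕ × ℕ × Bool) := do
  let i ← choose (Finset.range (C.card + 1)) 0
  if i < 2 then do
    let w ← choose C 0
    let e ← adjacent u w
    pure (u, w, !e)
  else pure s

/-- Update the entry of one threshold after the insertion of `u`, of degree `d`, into `B_v`. -/
def updateEntry (P : Params) (n u d : ℕ) (e : Entry) : DBM Entry :=
  if e.thr ≤ (d : ℝ) then do
    let old ← forEach (resample e.mem u) e.samples
    let new ← samplePairs (insert u e.mem) ⌈5 * Real.log n / P.eps ^ 3⌉₊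
    pure ⟨e.thr, insert u e.mem, old ++ new, e.rest + d⟩
  else pure { e with rest := e.rest + d }

/-- Successive comparison of the stored candidates. -/
def best (P : Params) : List Entry → Finset ℕ
  | [] => ∅
  | e :: es =>
    (es.foldl (fun cur x => if x.estimate P < cur.estimate P then x else cur) e).mem

/-- Update-cluster for the node `u` that has just been assigned to `v`. If the stored estimates
already account for `u` (possible only during a recomputation), nothing has to be done. -/
def updateCluster (P : Params) (n u v : ℕ) (st : State) : DBM State :=
  if u ∈ (st.store v).base then pure st
  else do
    let d ← degree u
    let es ← forEach (updateEntry P n u d) (st.store v).entries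
    pure { st with
      clus := Function.update st.clus v (best P es)
      store := Function.update st.store v ⟨insert u (st.store v).base, es⟩ }

/-! ## Insertion -/

open Classical in
/-- Explore, for a pivot `u`. A node without a pivot counts as having a pivot of infinite rank.
A node `z ∉ N(u)` whose pivot `w` is taken over keeps `p(z) = w`, and so becomes a singleton. -/
def explore (nodes : Finset ℕ) (rank : ℕ → unitInterval) (u : ℕ) (st : State) : DBM State := do
  let nb ← scan u
  (insert u nb).toList.foldlM (fun (st : State) (w : ℕ) =>
    if ∀ x, st.pivot w = some x → rank u < rank x then do
      let st' ←
        if st.IsPivot w then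
          (st.assigned nodes w).toList.foldlM (fun (s : State) (z : ℕ) => do
            let e ← adjacent u z
            pure (if e then s.setPivot z (some u) else s)) st
        else pure st
      pure (st'.setPivot w (some u))
    else pure st) st

/-- A uniformly random element of the closed neighbourhood of a node `u` of degree `d`. -/
def sampleClosed (u d : ℕ) : DBM ℕ := do
  let i ← choose (Finset.range (d + 1)) 0
  if i = 0 then pure u else randomNeighbor u

open Classical in
/-- The insertion procedure for the node `u`; `nodes` are the nodes of the current graph, `u`
included. The conditions `π(u) ≤ L / d` are written `π(u) * d ≤ L`, so that they hold for `d = 0`. -/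
def insertNode (P : Params) (nodes : Finset ℕ) (rank : ℕ → unitInterval) (st : State) (u : ℕ) :
    DBM State := do
  let n := nodes.card
  let d ← degree u
  if (rank u : ℝ) * d ≤ P.L n then
    let nb ← scan u
    match (insert u nb).toList.argmin rank with
    | none => pure st
    | some v =>
      if v = u then do
        let st₁ ← explore nodes rank u (st.setPivot u (some u))
        let r ← breakCluster P n (st₁.assigned nodes u)
        pure { st₁ with
          clus := Function.update st₁.clus u r.1
          store := Function.update st₁.store u r.2 }
      else if st.IsPivot v then do
        let st₁ ← updateCluster P n u v (st.setPivot u (some v))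
        let dv ← degree v
        if (rank u : ℝ) * dv ≤ P.L n then explore nodes rank v st₁ else pure st₁
      else pure (st.setPivot u (some v))
  else
    let S ← times (sampleClosed u d) ⌈P.sig * Real.log n⌉₊
    let cands ← forEach (fun s =>
      match st.pivot s with
      | none => pure none
      | some x => do
        let e ← adjacent x u
        pure (if e then some x else none)) S
    let unclustered : State :=
      if ∃ x, x ≠ u ∧ st.pivot u = some x then st else st.setPivot u none
    match (cands.filterMap id).argmin rank with
    | none => pure unclustered
    | some v =>
      if rank v < rank u then updateCluster P n u v (st.setPivot u (some v))
      else pure unclustered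

/-! ## Updates and recomputation -/

/-- An update: insertion of a node, or soft deletion of a node. -/
inductive Update where
  | insert (x : ℕ)
  | delete (x : ℕ)

/-- The situation after some updates: the nodes in the database, those among them that are marked
as soft-deleted, the number of recomputations so far, the number `n₀` of nodes just after the last
recomputation, the number of updates since then, and the state of the clustering algorithm. -/
structure World where
  nodes : Finset ℕ
  deleted : Finset ℕ
  epoch : ℕ
  n₀ : ℕ
  count : ℕ
  st : State

/-- The empty database. -/
def World.init : World := ⟨∅, ∅, 0, 0, 0, fun _ => none, fun _ => ∅, fun _ => ⟨∅, []⟩⟩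

/-- The ranks: `ranks (e, x)` is the rank of the node `x` between the `e`-th and the next
recomputation. -/
abbrev Ranks : Type := ℕ × ℕ → unitInterval

/-- All ranks are independent and uniformly distributed on `[0, 1]`. -/
def rankLaw : Measure Ranks := Measure.infinitePi fun _ => volume

open Classical in
/-- Recompute: purge the soft-deleted nodes, take new ranks, put `p(x) = x` for all nodes, and
insert the nodes one by one in the order of increasing rank. -/
def recompute (P : Params) (G : SimpleGraph ℕ) (ranks : Ranks) (w : World) : DBM World := do
  let live := w.nodes \ w.deleted
  let rank := fun x => ranks (w.epoch + 1, x)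
  let start : State :=
    ⟨fun x => if x ∈ live then some x else none, fun _ => ∅, fun _ => ⟨∅, []⟩⟩
  let st ← onDatabase ⟨G, live⟩
    ((live.toList.insertionSort fun x y => rank x ≤ rank y).foldlM (insertNode P live rank) start)
  pure ⟨live, ∅, w.epoch + 1, live.card, 0, st⟩

/-- Process the change of the database by one update. Insertions of present nodes and deletions of
absent nodes have no effect. Soft deletions are only recorded. -/
def applyUpdate (P : Params) (G : SimpleGraph ℕ) (ranks : Ranks) (w : World) :
    Update → DBM World
  | .insert x =>
    if x ∈ w.nodes then pure w
    else do
      let nodes := insert x w.nodes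
      let st ← onDatabase ⟨G, nodes⟩
        (insertNode P nodes (fun y => ranks (w.epoch, y)) w.st x)
      pure { w with nodes := nodes, st := st }
  | .delete x =>
    if x ∈ w.nodes then pure { w with deleted := insert x w.deleted } else pure w

open Classical in
/-- One update, followed by a recomputation if there have been at least `ε n₀ / 6` updates since
the last one. -/
def step (P : Params) (G : SimpleGraph ℕ) (ranks : Ranks) (w : World) (upd : Update) :
    DBM World := do
  let w₁ ← applyUpdate P G ranks w upd
  let w₂ : World := { w₁ with count := w₁.count + 1 }
  if P.eps * w₂.n₀ / 6 ≤ w₂.count then recompute P G ranks w₂ else pure w₂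

/-- Process a sequence of updates, starting from the empty database. -/
def process (P : Params) (G : SimpleGraph ℕ) (ranks : Ranks) (ups : List Update) : DBM World :=
  onDatabase ⟨G, ∅⟩ (ups.foldlM (step P G ranks) World.init)

/-! ## The probability of exceeding a number of database operations -/

/-- The upper integral. It is the integral if `f` is measurable, and never smaller. -/
def upperIntegral {Ω : Type} [MeasurableSpace Ω] (μ : Measure Ω) (f : Ω → ℝ≥0∞) : ℝ≥0∞ :=
  ⨅ (g : Ω → ℝ≥0∞) (_ : Measurable g) (_ : f ≤ g), ∫⁻ x, g x ∂μ

theorem lintegral_le_upperIntegral {Ω : Type} [MeasurableSpace Ω] (μ : Measure Ω)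
    (f : Ω → ℝ≥0∞) : ∫⁻ x, f x ∂μ ≤ upperIntegral μ f :=
  le_iInf fun _ => le_iInf fun _ => le_iInf fun h => lintegral_mono h

theorem upperIntegral_eq {Ω : Type} [MeasurableSpace Ω] (μ : Measure Ω)
    (f : Ω → ℝ≥0∞) (hf : Measurable f) : upperIntegral μ f = ∫⁻ x, f x ∂μ :=
  le_antisymm (iInf_le_of_le f (iInf_le_of_le hf (iInf_le_of_le le_rfl le_rfl)))
    (lintegral_le_upperIntegral μ f)

/-- The probability, over the ranks, the remaining coins of the algorithm and an independent random
sequence `U` of updates, that processing all updates, recomputations included, takes more than `b`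
database operations. -/
def exceedProb (P : Params) (G : SimpleGraph ℕ) (U : PMF (List Update)) (b : ℕ) : ℝ≥0∞ :=
  upperIntegral rankLaw fun ranks =>
    (U.bind fun ups => process P G ranks ups ⟨G, ∅⟩ b) none

end SparsePivot

end

/-! The proof is the exponential-moment method run through the whole algorithm. `ExpBound` is a
program logic for E exp(θ · (cost + potential of the result)): by `ExpBound.bind` bounds compose
along a program with no independence between its steps, since each step is bounded conditionally on
the past. Markov's inequality is applied only once, at the end.

Three sources of cost need an argument. A scan is a coupon collector with exponential moments of
order d log d as long as 2θT ≤ 1 (`expect_collect_le`). Update-cluster is cheap because a candidate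
C keeps at most m|C| samples, each replaced with probability about 1/|C| (`expBound_updateEntry`).
Explore may query all of B_w for many pivots w; this is amortized against the load, the number of
nodes assigned to a pivot: a captured pivot w stops being one, which releases all of B_w, whereas an
insertion raises the load only in proportion to a scanned degree (`expBound_explore`).

Hence inserting a node of rank x has amortized cost of order at most min(T, L/x) + 1, up to the
factor `insertCost` (`expBound_insertNode`). For a fixed update sequence the database and the times
of recomputation are deterministic, so the set S of ranks that are charged is fixed in advance; no
rank is charged twice, and |S| ≤ (6/ε + 2)T because a recomputation is paid for by the updates since
the last one (`exists_expBound_step`). The ranks in S are independent, and E min(T, L/x) ≤ 1 + L log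
T, so with θ of order 1/(T · `insertCost`) the exponential moment of the total is polylogarithmic in
the exponent (`lintegral_exp_rankCost_le`). Averaging over update sequences preserves this uniform
bound. -/

namespace SparsePivot

/-! ## Exponential moments of the number of database operations -/

/-- The expectation of a nonnegative function. -/
noncomputable def expect {α : Type} (p : PMF α) (V : α → ℝ≥0∞) : ℝ≥0∞ := ∑' r, p r * V r

theorem expect_pure {α : Type} (a : α) (V : α → ℝ≥0∞) : expect (PMF.pure a) V = V a := by
  unfold expect
  rw [tsum_eq_single a]
  · simp
  · intro b hb
    simp [PMF.pure_apply, hb]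

theorem expect_bind {α β : Type} (p : PMF α) (q : α → PMF β) (V : β → ℝ≥0∞) :
    expect (p.bind q) V = expect p fun a => expect (q a) V := by
  unfold expect
  simp only [PMF.bind_apply, ← ENNReal.tsum_mul_right, ← ENNReal.tsum_mul_left]
  rw [ENNReal.tsum_comm]
  simp only [mul_assoc]

theorem expect_map {α β : Type} (p : PMF α) (g : α → β) (V : β → ℝ≥0∞) :
    expect (p.map g) V = expect p fun a => V (g a) := by
  rw [PMF.map, expect_bind]
  simp [expect_pure]

theorem expect_mono {α : Type} (p : PMF α) {V W : α → ℝ≥0∞} (h : ∀ a, V a ≤ W a) :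
    expect p V ≤ expect p W :=
  ENNReal.tsum_le_tsum fun a => by gcongr; exact h a

theorem expect_mul_const {α : Type} (p : PMF α) (V : α → ℝ≥0∞) (c : ℝ≥0∞) :
    expect p (fun a => V a * c) = expect p V * c := by
  simp only [expect, ← mul_assoc, ENNReal.tsum_mul_right]

theorem expect_uniformOfFinset {α : Type} [DecidableEq α] (s : Finset α) (h : s.Nonempty)
    (V : α → ℝ≥0∞) :
    expect (PMF.uniformOfFinset s h) V = (s.card : ℝ≥0∞)⁻¹ * ∑ x ∈ s, V x := by
  unfold expect
  rw [tsum_eq_sum (s := s), Finset.mul_sum]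
  · refine Finset.sum_congr rfl fun x hx => ?_
    rw [PMF.uniformOfFinset_apply_of_mem h hx]
  · intro b hb
    rw [PMF.uniformOfFinset_apply_of_notMem h hb, zero_mul]

open Classical in
/-- The exponential weight of an outcome with postcondition `Q` and potential `f`. Running out of
budget has weight `1`, a violation of `Q` has weight `∞`. -/
noncomputable def weight {α : Type} (θ : ℝ) (Q : α → Prop) (f : α → ℝ) : Option (α × ℕ) → ℝ≥0∞
  | none => 1
  | some (a, b) => if Q a then ENNReal.ofReal (Real.exp (θ * (f a - b))) else ⊤

/-- `ExpBound θ db m w Q f`: almost surely the result `a` of `m` satisfies `Q`, and the exponential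
moment of (number of operations) `+ f a` with parameter `θ` is at most `exp (θ * w)`. -/
def ExpBound {α : Type} (θ : ℝ) (db : Database) (m : DBM α) (w : ℝ) (Q : α → Prop)
    (f : α → ℝ) : Prop :=
  ∀ b : ℕ, expect (m db b) (weight θ Q f) ≤ ENNReal.ofReal (Real.exp (θ * (w - b)))

namespace ExpBound

variable {α β : Type} {θ : ℝ} {db : Database} {m : DBM α} {w w' : ℝ} {Q Q' : α → Prop}
  {f f' : α → ℝ}

theorem pure {a : α} (hQ : Q a) (hw : f a ≤ w) (hθ : 0 ≤ θ) :
    ExpBound θ db (pure a : DBM α) w Q f := by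
  intro b
  change expect (PMF.pure (some (a, b))) _ ≤ _
  rw [expect_pure]
  simp only [weight, hQ, if_true]
  gcongr

/-- The weight of an outcome `(a, b')` of `m` is exactly the bound that the continuation must meet
from `a` with `b'` operations left. The weight `∞` for violations of `Q` lets the continuation
assume `Q`. -/
theorem bind {k : α → DBM β} {R : β → Prop} {g : β → ℝ} (h : ExpBound θ db m w Q f)
    (hk : ∀ a, Q a → ExpBound θ db (k a) (f a) R g) :
    ExpBound θ db (m >>= k) w R g := by
  intro b
  change expect ((m db b).bind _) _ ≤ _
  rw [expect_bind]
  refine le_trans (expect_mono _ ?_) (h b)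
  rintro (_ | ⟨a, b'⟩)
  · change expect (PMF.pure none) _ ≤ _
    rw [expect_pure]; rfl
  · by_cases hQ : Q a
    · simpa only [weight, hQ, if_true] using hk a hQ b'
    · simp [weight, hQ]

theorem mono (h : ExpBound θ db m w Q f) (hθ : 0 ≤ θ) (hw : w ≤ w')
    (hQ : ∀ a, Q a → Q' a) (hf : ∀ a, Q a → f' a ≤ f a) : ExpBound θ db m w' Q' f' := by
  intro b
  refine le_trans (expect_mono _ ?_) ((h b).trans ?_)
  · rintro (_ | ⟨a, b'⟩)
    · rfl
    · by_cases h1 : Q a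
      · simp only [weight, h1, hQ a h1, if_true]
        have := hf a h1
        gcongr
      · simp [weight, h1]
  · gcongr

/-- Everything scales by exp (θc), except the weight 1 of running out of budget; that is where `0 ≤
c` enters. -/
theorem frame (h : ExpBound θ db m w Q f) (hθ : 0 ≤ θ) {c : ℝ} (hc : 0 ≤ c) :
    ExpBound θ db m (w + c) Q (fun a => f a + c) := by
  intro b
  have key : ∀ x : ℝ, ENNReal.ofReal (Real.exp (θ * (x + c - b))) =
      ENNReal.ofReal (Real.exp (θ * (x - b))) * ENNReal.ofReal (Real.exp (θ * c)) := fun x => by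
    rw [← ENNReal.ofReal_mul (Real.exp_nonneg _), ← Real.exp_add]; ring_nf
  have key' : ∀ (x : ℝ) (b : ℕ), ENNReal.ofReal (Real.exp (θ * (x + c - b))) =
      ENNReal.ofReal (Real.exp (θ * (x - b))) * ENNReal.ofReal (Real.exp (θ * c)) := fun x b => by
    rw [← ENNReal.ofReal_mul (Real.exp_nonneg _), ← Real.exp_add]; ring_nf
  rw [key]
  refine le_trans (expect_mono _ (W := fun r => weight θ Q f r *
    ENNReal.ofReal (Real.exp (θ * c))) ?_) ?_
  · rintro (_ | ⟨a, b'⟩)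
    · simp only [weight, one_mul]
      exact ENNReal.one_le_ofReal.2 (Real.one_le_exp (by positivity))
    · by_cases h1 : Q a
      · simp only [weight, h1, if_true, key', le_refl]
      · have : ENNReal.ofReal (Real.exp (θ * c)) ≠ 0 := by
          simp [Real.exp_pos]
        simp [weight, h1, this]
  · rw [expect_mul_const]
    gcongr
    exact h b

/-- Sequential composition when the first computation has a constant cost bound. -/
theorem bind_cost {k : α → DBM β} {R : β → Prop} {g : β → ℝ} {v : ℝ}
    (h : ExpBound θ db m w Q fun _ => 0) (hθ : 0 ≤ θ) (hv : 0 ≤ v)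
    (hk : ∀ a, Q a → ExpBound θ db (k a) v R g) :
    ExpBound θ db (m >>= k) (w + v) R g :=
  (h.frame hθ hv).bind fun a ha => by simpa using hk a ha

theorem tick (hθ : 0 ≤ θ) : ExpBound θ db SparsePivot.tick 1 (fun _ => True) fun _ => 0 := by
  intro b
  rcases b with _ | b
  · change expect (PMF.pure none) _ ≤ _
    rw [expect_pure]
    simp only [weight]
    exact ENNReal.one_le_ofReal.2 (Real.one_le_exp (by simpa using hθ))
  · change expect (PMF.pure (some ((), b))) _ ≤ _
    rw [expect_pure]
    simp only [weight, if_true]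
    push_cast
    exact ENNReal.ofReal_le_ofReal (Real.exp_le_exp.2 (by apply le_of_eq; ring))

theorem look {g : Database → α} (hQ : Q (g db)) (hθ : 0 ≤ θ) (hw : f (g db) ≤ w) :
    ExpBound θ db (SparsePivot.look g) w Q f := by
  intro b
  change expect (PMF.pure (some (g db, b))) _ ≤ _
  rw [expect_pure]
  simp only [weight, hQ, if_true]
  gcongr

theorem choose {s : Finset ℕ} {dflt : ℕ} {Q : ℕ → Prop} {f : ℕ → ℝ} (hθ : 0 ≤ θ)
    (hs : ∀ x ∈ s, Q x) (hd : s = ∅ → Q dflt ∧ f dflt ≤ w)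
    (hw : ∑ x ∈ s, Real.exp (θ * f x) ≤ s.card * Real.exp (θ * w)) :
    ExpBound θ db (choose s dflt) w Q f := by
  classical
  intro b
  unfold SparsePivot.choose
  by_cases h : s.Nonempty
  · rw [dif_pos h, expect_map, expect_uniformOfFinset]
    have hc : (0 : ℝ) < s.card := by exact_mod_cast h.card_pos
    have h1 : ∑ x ∈ s, weight θ Q f (some (x, b)) =
        ENNReal.ofReal (∑ x ∈ s, Real.exp (θ * (f x - b))) := by
      rw [ENNReal.ofReal_sum_of_nonneg fun _ _ => Real.exp_nonneg _]
      exact Finset.sum_congr rfl fun x hx => by simp [weight, hs x hx]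
    rw [h1, ← ENNReal.ofReal_natCast, ← ENNReal.ofReal_inv_of_pos hc,
      ← ENNReal.ofReal_mul (by positivity)]
    refine ENNReal.ofReal_le_ofReal ?_
    have h2 : ∀ x : ℝ, Real.exp (θ * (x - b)) = Real.exp (θ * x) * Real.exp (-(θ * b)) :=
      fun x => by rw [← Real.exp_add]; ring_nf
    simp only [h2, ← Finset.sum_mul]
    rw [← mul_assoc]
    gcongr
    rw [inv_mul_le_iff₀ hc]
    exact hw
  · rw [dif_neg h, expect_pure]
    obtain ⟨h1, h2⟩ := hd (Finset.not_nonempty_iff_eq_empty.1 h)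
    simp only [weight, h1, if_true]
    gcongr

theorem choose_cost {s : Finset ℕ} {dflt : ℕ} (hθ : 0 ≤ θ) :
    ExpBound θ db (SparsePivot.choose s dflt) 0 (fun x => x ∈ s ∨ s = ∅ ∧ x = dflt) fun _ => 0 := by
  refine ExpBound.choose hθ (fun x hx => Or.inl hx) (fun h => ⟨Or.inr ⟨h, rfl⟩, le_rfl⟩) ?_
  simp

theorem forEach {F : α → DBM β} {R : β → Prop} {c : ℝ} (hθ : 0 ≤ θ) (hc : 0 ≤ c) (xs : List α)
    (h : ∀ x ∈ xs, ExpBound θ db (F x) c R fun _ => 0) :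
    ExpBound θ db (SparsePivot.forEach F xs) (xs.length * c)
      (fun ys => ys.length = xs.length ∧ ∀ y ∈ ys, R y) fun _ => 0 := by
  induction xs with
  | nil => exact ExpBound.pure (by simp) (by simp) hθ
  | cons x xs ih =>
    have ih := ih fun y hy => h y (List.mem_cons_of_mem _ hy)
    rw [List.length_cons, Nat.cast_succ, add_mul, one_mul, add_comm]
    refine (h x List.mem_cons_self).bind_cost hθ (by positivity) fun y hy => ?_
    rw [← add_zero ((xs.length : ℝ) * c)]
    refine ih.bind_cost hθ le_rfl fun ys hys => ?_
    refine ExpBound.pure ⟨by simp [hys.1], ?_⟩ le_rfl hθ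
    intro z hz
    rcases List.mem_cons.1 hz with rfl | hz
    exacts [hy, hys.2 z hz]

theorem times {R : α → Prop} {c : ℝ} (hθ : 0 ≤ θ) (hc : 0 ≤ c) (k : ℕ)
    (h : ExpBound θ db m c R fun _ => 0) :
    ExpBound θ db (SparsePivot.times m k) (k * c)
      (fun ys => ys.length = k ∧ ∀ y ∈ ys, R y) fun _ => 0 := by
  have := forEach (F := fun _ => m) hθ hc (List.range k) fun _ _ => h
  simpa [SparsePivot.times] using this

/-- The amortized analysis of a loop: `g` is the potential of its state and `c x` the amortized cost
of a round, which may be far below the actual cost when `g` drops. -/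
theorem foldlM {F : β → α → DBM β} {R : β → Prop} {g : β → ℝ} {c : α → ℝ} (hθ : 0 ≤ θ)
    (xs : List α) (hc : ∀ x ∈ xs, 0 ≤ c x)
    (h : ∀ x ∈ xs, ∀ s, R s → ExpBound θ db (F s x) (g s + c x) R g) (s : β) (hs : R s) :
    ExpBound θ db (xs.foldlM F s) (g s + (xs.map c).sum) R g := by
  induction xs generalizing s with
  | nil => exact ExpBound.pure hs (by simp) hθ
  | cons x xs ih =>
    rw [List.foldlM_cons, List.map_cons, List.sum_cons, ← add_assoc]
    have hnn : 0 ≤ (xs.map c).sum := List.sum_nonneg fun y hy => by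
      obtain ⟨z, hz, rfl⟩ := List.mem_map.1 hy
      exact hc z (List.mem_cons_of_mem _ hz)
    refine ((h x List.mem_cons_self s hs).frame hθ hnn).bind fun s' hs' => ?_
    exact ih (fun y hy => hc y (List.mem_cons_of_mem _ hy))
      (fun y hy => h y (List.mem_cons_of_mem _ hy)) s' hs'

theorem foldlM_const {F : β → α → DBM β} {R : β → Prop} {g : β → ℝ} {c : ℝ} (hθ : 0 ≤ θ)
    (hc : 0 ≤ c) (xs : List α)
    (h : ∀ x ∈ xs, ∀ s, R s → ExpBound θ db (F s x) (g s + c) R g) (s : β) (hs : R s) :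
    ExpBound θ db (xs.foldlM F s) (g s + xs.length * c) R g := by
  simpa using foldlM (c := fun _ => c) hθ xs (fun _ _ => hc) h s hs

theorem onDatabase (h : ExpBound θ db m w Q f) (db' : Database) :
    ExpBound θ db' (SparsePivot.onDatabase db m) w Q f := h

/-- Markov's inequality for the number of database operations. -/
theorem prob_none_le (h : ExpBound θ db m w Q f) (b : ℕ) :
    m db b none ≤ ENNReal.ofReal (Real.exp (θ * (w - b))) := by
  refine le_trans ?_ (h b)
  have := ENNReal.le_tsum (f := fun r => m db b r * weight θ Q f r) none
  simpa [weight, expect] using this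

end ExpBound

/-! ## The three database operations and scans -/

variable {θ : ℝ} {db : Database}

theorem expBound_degree (hθ : 0 ≤ θ) (v : ℕ) :
    ExpBound θ db (degree v) 1 (fun d => d = (db.nbrs v).card) fun _ => 0 := by
  rw [← add_zero (1 : ℝ)]
  exact (ExpBound.tick hθ).bind_cost hθ le_rfl fun _ _ => ExpBound.look rfl hθ le_rfl

theorem expBound_randomNeighbor (hθ : 0 ≤ θ) (v : ℕ) :
    ExpBound θ db (randomNeighbor v) 1 (fun _ => True) fun _ => 0 := by
  rw [← add_zero (1 : ℝ)]
  refine (ExpBound.tick hθ).bind_cost hθ le_rfl fun _ _ => ?_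
  refine (ExpBound.look (w := 0) (f := fun _ => 0) (Q := fun _ => True) trivial hθ le_rfl).bind
    fun s _ => (ExpBound.choose_cost hθ).mono hθ le_rfl (fun _ _ => trivial) fun _ _ => le_rfl

theorem expBound_adjacent (hθ : 0 ≤ θ) (v w : ℕ) :
    ExpBound θ db (adjacent v w) 1 (fun e => e = true → w ∈ db.nbrs v) fun _ => 0 := by
  rw [← add_zero (1 : ℝ)]
  exact (ExpBound.tick hθ).bind_cost hθ le_rfl fun _ _ => ExpBound.look (by simp) hθ le_rfl

/-- One step of the coupon collector: with probability `p` the potential drops by `2 / p`. -/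
theorem exp_coupon_le {p : ℝ} (hθ : 0 ≤ θ) (hp : 0 < p) (h : 2 * θ ≤ p) :
    Real.exp θ * (p * Real.exp (-(θ * (2 / p))) + (1 - p)) ≤ 1 := by
  set x := θ * (2 / p) with hx
  have hx0 : 0 ≤ x := by positivity
  have hx1 : x ≤ 1 := by
    rw [hx, ← mul_div_assoc, div_le_one hp]; linarith
  have hpx : p * x = 2 * θ := by rw [hx]; field_simp
  -- On [0, 1], exp(-x) ≤ 1/(1 + x) ≤ 1 - x/2. Half of the drop is lost here, hence the factor 2 in
  -- `couponBound`; since p x = 2θ, the gain 1 - θ still cancels the price exp θ of the query.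
  have h1 : Real.exp (-x) ≤ 1 - x / 2 := by
    have h2 : Real.exp (-x) * (1 + x) ≤ 1 := by
      calc _ ≤ Real.exp (-x) * Real.exp x := by gcongr; linarith [Real.add_one_le_exp x]
        _ = 1 := by rw [← Real.exp_add]; simp
    nlinarith
  have h2 : p * Real.exp (-x) + (1 - p) ≤ 1 - θ := by nlinarith
  have h3 : 1 - θ ≤ Real.exp (-θ) := by linarith [Real.add_one_le_exp (-θ)]
  calc _ ≤ Real.exp θ * Real.exp (-θ) := by gcongr; linarith
    _ = 1 := by rw [← Real.exp_add]; simp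

/-- The bound for the coupon collector that still misses `j` of `d` coupons. -/
noncomputable def couponBound (d j : ℕ) : ℝ := 2 * d * ∑ i ∈ Finset.range j, 1 / ((i : ℝ) + 1)

theorem couponBound_nonneg (d j : ℕ) : 0 ≤ couponBound d j := by
  unfold couponBound; positivity

/-- Induction on the budget, because the number of queries is unbounded. With j + 1 of d neighbours
missing, a query finds a new one with probability p = (j + 1)/d, and then `exp_coupon_le` applies.
The smallest p is 1/d, which explains the condition on θ. -/
theorem expect_collect_le (hθ : 0 ≤ θ) (v : ℕ) (hd : 2 * θ * (db.nbrs v).card ≤ 1) (b : ℕ)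
    (seen : Finset ℕ) (hs : seen ⊆ db.nbrs v) :
    expect (collect v (db.nbrs v).card db b seen) (weight θ (fun s => s = db.nbrs v) fun _ => 0) ≤
      ENNReal.ofReal (Real.exp (θ *
        (couponBound (db.nbrs v).card ((db.nbrs v).card - seen.card) - b))) := by
  classical
  set N := db.nbrs v with hN
  have expect_full : ∀ (b : ℕ) (seen : Finset ℕ), seen ⊆ N → N.card ≤ seen.card →
      expect (PMF.pure (some (seen, b))) (weight θ (fun s => s = N) fun _ => 0) ≤
      ENNReal.ofReal (Real.exp (θ * (couponBound N.card (N.card - seen.card) - b))) := by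
    intro b seen hs hc
    have := Finset.eq_of_subset_of_card_le hs hc
    rw [expect_pure]
    simp only [weight, this, if_true]
    have := couponBound_nonneg N.card (N.card - N.card)
    gcongr
  induction b generalizing seen with
  | zero =>
    unfold collect
    split_ifs with h
    · exact expect_full 0 seen hs h
    · rw [expect_pure]
      have := couponBound_nonneg N.card (N.card - seen.card)
      exact ENNReal.one_le_ofReal.2 (Real.one_le_exp (by simpa using mul_nonneg hθ this))
  | succ b ih =>
    unfold collect
    split_ifs with h
    · exact expect_full _ seen hs h
    have hne : N.Nonempty := Finset.card_pos.1 (by omega)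
    have hrn : randomNeighbor v db 1 = (PMF.uniformOfFinset N hne).map fun x => some (x, 0) := by
      change (PMF.pure (some ((), 0))).bind _ = _
      rw [PMF.pure_bind]
      change (PMF.pure (some (N, 0))).bind _ = _
      rw [PMF.pure_bind]
      change choose N v db 0 = _
      rw [choose, dif_pos hne]
    rw [hrn, expect_bind, expect_map]
    have hd0 : (0 : ℝ) < N.card := by exact_mod_cast hne.card_pos
    obtain ⟨j, hj⟩ : ∃ j, N.card - seen.card = j + 1 := ⟨N.card - seen.card - 1, by omega⟩
    have hjc : (N \ seen).card = j + 1 := by rw [Finset.card_sdiff_of_subset hs, hj]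
    have hjN : j + 1 ≤ N.card := by omega
    rw [expect_uniformOfFinset, ← Finset.sum_sdiff hs]
    have e1 : ∀ x ∈ N \ seen, expect (collect v N.card db b (insert x seen))
        (weight θ (fun s => s = N) fun _ => 0) ≤
        ENNReal.ofReal (Real.exp (θ * (couponBound N.card j - b))) := by
      intro x hx
      rw [Finset.mem_sdiff] at hx
      have := ih (insert x seen) (Finset.insert_subset hx.1 hs)
      rwa [Finset.card_insert_of_notMem hx.2, ← Nat.sub_sub, hj, Nat.add_sub_cancel] at this
    have e2 : ∀ x ∈ seen, expect (collect v N.card db b (insert x seen))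
        (weight θ (fun s => s = N) fun _ => 0) ≤
        ENNReal.ofReal (Real.exp (θ * (couponBound N.card (j + 1) - b))) := by
      intro x hx
      have := ih seen hs
      rwa [Finset.insert_eq_of_mem hx, ← hj]
    have hsc : (seen.card : ℝ) = N.card - (j + 1) := by
      have : seen.card + (j + 1) = N.card := by omega
      rw [← this]; push_cast; ring
    rw [hj]
    refine le_trans (mul_le_mul_right (add_le_add (Finset.sum_le_card_nsmul _ _ _ e1)
      (Finset.sum_le_card_nsmul _ _ _ e2)) _) ?_
    rw [hjc, nsmul_eq_mul, nsmul_eq_mul, ← ENNReal.ofReal_natCast, ← ENNReal.ofReal_natCast,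
      ← ENNReal.ofReal_natCast, ← ENNReal.ofReal_mul (by positivity),
      ← ENNReal.ofReal_mul (by positivity), ← ENNReal.ofReal_add (by positivity) (by positivity),
      ← ENNReal.ofReal_inv_of_pos hd0, ← ENNReal.ofReal_mul (by positivity), hsc]
    refine ENNReal.ofReal_le_ofReal ?_
    set p : ℝ := ((j : ℝ) + 1) / N.card with hp
    have hp0 : 0 < p := by positivity
    have hdrop : couponBound N.card j = couponBound N.card (j + 1) - 2 / p := by
      unfold couponBound
      rw [Finset.sum_range_succ, hp]
      field_simp
      ring
    set W := couponBound N.card (j + 1)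
    have h2 : 2 * θ ≤ p := by
      rw [hp, le_div_iff₀ hd0]
      have : (0 : ℝ) ≤ j := by positivity
      linarith
    have hx := exp_coupon_le hθ hp0 h2
    have s1 : Real.exp (θ * (couponBound N.card j - b)) =
        Real.exp (θ * (W - (b + 1))) * Real.exp θ * Real.exp (-(θ * (2 / p))) := by
      rw [hdrop, ← Real.exp_add, ← Real.exp_add]; ring_nf
    have s2 : Real.exp (θ * (W - b)) = Real.exp (θ * (W - (b + 1))) * Real.exp θ := by
      rw [← Real.exp_add]; ring_nf
    rw [s1, s2]
    push_cast
    calc _ = Real.exp (θ * (W - (b + 1))) *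
          (Real.exp θ * (p * Real.exp (-(θ * (2 / p))) + (1 - p))) := by
          rw [hp]; field_simp
      _ ≤ Real.exp (θ * (W - (b + 1))) * 1 := by gcongr
      _ = _ := mul_one _

theorem couponBound_le {d T : ℕ} (hdT : d ≤ T) :
    couponBound d d ≤ d * (2 * (1 + Real.log T)) := by
  have hh : ∑ i ∈ Finset.range d, 1 / ((i : ℝ) + 1) ≤ 1 + Real.log T := by
    rcases Nat.eq_zero_or_pos d with rfl | h
    · have := Real.log_natCast_nonneg T
      simp; linarith
    · have h1 := harmonic_le_one_add_log d
      have h2 : Real.log d ≤ Real.log T :=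
        Real.log_le_log (by exact_mod_cast h) (by exact_mod_cast hdT)
      have h3 : ((harmonic d : ℚ) : ℝ) = ∑ i ∈ Finset.range d, 1 / ((i : ℝ) + 1) := by
        simp [harmonic]
      linarith
  unfold couponBound
  nlinarith [(Nat.cast_nonneg d : (0 : ℝ) ≤ d)]

theorem expBound_scan (hθ : 0 ≤ θ) {T : ℕ} (hθT : 2 * θ * T ≤ 1) (v : ℕ)
    (hv : (db.nbrs v).card ≤ T) :
    ExpBound θ db (scan v) (1 + (db.nbrs v).card * (2 * (1 + Real.log T)))
      (fun s => s = db.nbrs v) fun _ => 0 := by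
  have hl := Real.log_natCast_nonneg T
  refine (expBound_degree hθ v).bind_cost hθ (by positivity) ?_
  rintro _ rfl b
  have hv' : ((db.nbrs v).card : ℝ) ≤ T := by exact_mod_cast hv
  refine (expect_collect_le hθ v (le_trans (by gcongr) hθT) b ∅ (Finset.empty_subset _)).trans ?_
  rw [Finset.card_empty, Nat.sub_zero]
  have := couponBound_le hv
  gcongr

end SparsePivot

/-! ### Parameters and invariants of the stored data -/

namespace SparsePivot

/-- Uniform bounds, for up to `T` nodes, on the numbers that govern the running time: `m` bounds the
number of samples per node, `H` the number of candidates, `s` the number of sampled neighbours. -/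
structure Bounds (P : Params) (θ : ℝ) (T m H s : ℕ) : Prop where
  theta_nonneg : 0 ≤ θ
  theta_le : 2 * θ * T ≤ 1
  one_le : 1 ≤ T
  eps_pos : 0 < P.eps
  lam_nonneg : 0 ≤ P.lam
  sig_nonneg : 0 ≤ P.sig
  samples : 10 * Real.log T / P.eps ^ 3 ≤ m
  candidates : ⌈Real.log T / Real.log (1 + P.eps)⌉₊ + 2 ≤ H
  neighbours : ⌈P.sig * Real.log T⌉₊ ≤ s

/-- The invariant of what is stored for a pivot. -/
def Store.Inv (m H : ℕ) (S : Store) : Prop :=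
  S.entries.length ≤ H ∧ ∀ e ∈ S.entries, e.mem ⊆ S.base ∧ e.samples.length ≤ m * e.mem.card

/-- The invariant of the state of the clustering algorithm. -/
structure State.Inv (G : SimpleGraph ℕ) (m H : ℕ) (st : State) : Prop where
  adj : ∀ z v, st.pivot z = some v → z = v ∨ G.Adj v z
  store : ∀ v, (st.store v).Inv m H

variable {P : Params} {θ : ℝ} {T m H s n : ℕ} {db : Database} {G : SimpleGraph ℕ}

theorem log_natCast_le_log (hn : 1 ≤ n) (hnT : n ≤ T) : Real.log n ≤ Real.log T :=
  Real.log_le_log (by exact_mod_cast hn) (by exact_mod_cast hnT)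

/-! ## Cost estimates -/

theorem expBound_samplePair (hθ : 0 ≤ θ) (C : Finset ℕ) :
    ExpBound θ db (samplePair C) 1 (fun _ => True) fun _ => 0 := by
  unfold samplePair
  refine (ExpBound.choose_cost hθ).bind_cost hθ zero_le_one (fun a _ => ?_) |>.mono hθ
    (by norm_num : (0 : ℝ) + 1 ≤ 1) (fun _ h => h) fun _ _ => le_rfl
  refine (ExpBound.choose_cost hθ).bind_cost hθ zero_le_one (fun b _ => ?_) |>.mono hθ
    (by norm_num : (0 : ℝ) + 1 ≤ 1) (fun _ h => h) fun _ _ => le_rfl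
  refine (expBound_adjacent hθ a b).bind_cost hθ le_rfl (fun e _ => ?_) |>.mono hθ
    (by norm_num : (1 : ℝ) + 0 ≤ 1) (fun _ h => h) fun _ _ => le_rfl
  exact ExpBound.pure trivial le_rfl hθ

theorem expBound_samplePairs (hθ : 0 ≤ θ) (C : Finset ℕ) (k : ℕ) :
    ExpBound θ db (samplePairs C k) k (fun l => l.length ≤ k) fun _ => 0 := by
  unfold samplePairs
  split_ifs
  · exact ((expBound_samplePair hθ C).times hθ zero_le_one k).mono hθ (by simp)
      (fun l hl => hl.1.le) fun _ _ => le_rfl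
  · exact ExpBound.pure (by simp) (by positivity) hθ

theorem expBound_singletonCost (hθ : 0 ≤ θ) (B C : Finset ℕ) (eta w : ℕ) :
    ExpBound θ db (singletonCost B C eta w) (1 + eta) (fun _ => True) fun _ => 0 := by
  unfold singletonCost
  refine (expBound_degree hθ w).bind_cost hθ (by positivity) fun d _ => ?_
  refine ((expBound_randomNeighbor hθ w).times hθ zero_le_one eta).bind_cost hθ le_rfl
    (fun xs _ => ?_) |>.mono hθ (by simp) (fun _ h => h) fun _ _ => le_rfl
  exact ExpBound.pure trivial le_rfl hθ

theorem Bounds.ceil_samples_le (h : Bounds P θ T m H s) (hn : 1 ≤ n) (hnT : n ≤ T) :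
    ⌈10 * Real.log n / P.eps ^ 3⌉₊ ≤ m := by
  have := log_natCast_le_log hn hnT
  have := h.eps_pos
  exact Nat.ceil_le.2 (le_trans (by gcongr) h.samples)

theorem Bounds.ceil_card_samples_le (h : Bounds P θ T m H s) (hn : 1 ≤ n) (hnT : n ≤ T) (c : ℕ) :
    ⌈5 * (c : ℝ) * Real.log n / P.eps ^ 3⌉₊ ≤ m * c := by
  have h1 := log_natCast_le_log hn hnT
  have h2 := h.eps_pos
  have h3 := Real.log_natCast_nonneg n
  rw [Nat.ceil_le]
  have h4 : 10 * Real.log n / P.eps ^ 3 ≤ m := le_trans (by gcongr) h.samples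
  have h5 : 0 ≤ Real.log n / P.eps ^ 3 := by positivity
  push_cast
  calc 5 * (c : ℝ) * Real.log n / P.eps ^ 3 = 5 * (Real.log n / P.eps ^ 3) * c := by ring
    _ ≤ (10 * Real.log n / P.eps ^ 3) * c := by
      gcongr
      rw [mul_div_assoc]; linarith
    _ ≤ m * c := by gcongr

theorem expBound_costEstimate (h : Bounds P θ T m H s) (hn : 1 ≤ n) (hnT : n ≤ T)
    {B C : Finset ℕ} (hC : C ⊆ B) (t : ℝ) :
    ExpBound θ db (costEstimate P n B C t) (B.card * (2 + 2 * m))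
      (fun e => e.mem = C ∧ e.samples.length ≤ m * C.card) fun _ => 0 := by
  have hθ := h.theta_nonneg
  have k1 : ((⌈5 * (C.card : ℝ) * Real.log n / P.eps ^ 3⌉₊ : ℕ) : ℝ) ≤ m * C.card := by
    exact_mod_cast h.ceil_card_samples_le hn hnT C.card
  have k2 : ((⌈10 * Real.log n / P.eps ^ 3⌉₊ : ℕ) : ℝ) ≤ m := by
    exact_mod_cast h.ceil_samples_le hn hnT
  have c1 : (C.card : ℝ) ≤ B.card := by exact_mod_cast Finset.card_le_card hC
  have c2 : ((B \ C).card : ℝ) ≤ B.card := by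
    exact_mod_cast Finset.card_le_card Finset.sdiff_subset
  unfold costEstimate
  have e1 : ExpBound θ db (forEach degree C.toList) C.card (fun _ => True) fun _ => 0 :=
    (ExpBound.forEach hθ zero_le_one C.toList fun x _ => (expBound_degree hθ x).mono hθ le_rfl
      (Q' := fun _ => True) (fun _ _ => trivial) fun _ _ => le_rfl).mono hθ (by simp)
      (fun _ _ => trivial) fun _ _ => le_rfl
  refine ExpBound.mono (w := C.card + (m * C.card + (B.card * (1 + m) + 0))) ?_ hθ ?_
    (fun _ h => h) fun _ _ => le_rfl
  · refine e1.bind_cost hθ (by positivity) fun ds _ => ?_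
    refine ((expBound_samplePairs hθ C _).mono hθ k1 (fun _ h => h)
      fun _ _ => le_rfl).bind_cost hθ (by positivity) fun smp hsmp => ?_
    have e3 := ExpBound.forEach (db := db) hθ (by positivity) (B \ C).toList
      fun x _ => expBound_singletonCost (db := db) hθ B C ⌈10 * Real.log n / P.eps ^ 3⌉₊ x
    refine (e3.mono hθ ?_ (fun _ h => h) fun _ _ => le_rfl).bind_cost hθ le_rfl fun zs _ => ?_
    · rw [Finset.length_toList]
      gcongr
    · exact ExpBound.pure ⟨rfl, hsmp.trans (h.ceil_card_samples_le hn hnT _)⟩ le_rfl hθ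
  · have : (m : ℝ) * C.card ≤ m * B.card := by gcongr
    linarith

theorem expBound_breakCluster (h : Bounds P θ T m H s) (hn : 1 ≤ n) (hnT : n ≤ T)
    (B : Finset ℕ) :
    ExpBound θ db (breakCluster P n B) (B.card * (1 + 2 * H * (2 + 2 * m)))
      (fun r => r.2.Inv m H) fun _ => 0 := by
  have hθ := h.theta_nonneg
  -- The `+ 2` in `Bounds.candidates` stands for the power with exponent 0 and for the entry of
  -- threshold 0.
  have hlen : (thresholds P n).length + 1 ≤ H := by
    refine le_trans ?_ h.candidates
    have h1 := log_natCast_le_log hn hnT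
    have h2 : 0 < Real.log (1 + P.eps) := Real.log_pos (by linarith [h.eps_pos])
    have : ⌈Real.log n / Real.log (1 + P.eps)⌉₊ ≤ ⌈Real.log T / Real.log (1 + P.eps)⌉₊ :=
      Nat.ceil_mono (by gcongr)
    simp only [thresholds, List.length_map, List.length_range]
    omega
  have hlen' : ((thresholds P n).length : ℝ) + 1 ≤ H := by exact_mod_cast hlen
  unfold breakCluster
  have e1 : ExpBound θ db (forEach (fun w => do let d ← degree w; pure (w, d)) B.toList) B.card
      (fun ds => ∀ x ∈ ds, x.1 ∈ B) fun _ => 0 := by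
    refine (ExpBound.forEach (c := 1 + 0) (R := fun x => x.1 ∈ B) hθ (by norm_num) B.toList
      fun x hx => ?_).mono hθ (by simp) (fun _ h => h.2) fun _ _ => le_rfl
    refine (expBound_degree hθ x).bind_cost hθ le_rfl fun d _ => ?_
    exact ExpBound.pure (Finset.mem_toList.1 hx) le_rfl hθ
  set c : ℝ := B.card * (2 + 2 * m) with hc
  have hc0 : 0 ≤ c := by positivity
  refine ExpBound.mono (w := B.card + (c + ((0 + (thresholds P n).length * (2 * c)) + 0))) ?_ hθ ?_
    (fun _ h => h) fun _ _ => le_rfl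
  · refine e1.bind_cost hθ (by positivity) fun ds hds => ?_
    refine (expBound_costEstimate h hn hnT subset_rfl 0).bind_cost hθ (by positivity)
      fun e₀ he₀ => ?_
    have hC : ∀ t : ℝ, ((ds.filter fun x => decide (t ≤ (x.2 : ℝ))).map Prod.fst).toFinset ⊆ B := by
      intro t x hx
      rw [List.mem_toFinset, List.mem_map] at hx
      obtain ⟨y, hy, rfl⟩ := hx
      exact hds y (List.mem_filter.1 hy).1
    -- the number of entries is controlled through the length of the remaining list
    have e2 : ∀ (ts : List ℝ) (r : Finset ℕ × List Entry), r.1 ⊆ B →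
        r.2.length + ts.length ≤ H →
        (∀ e ∈ r.2, e.mem ⊆ B ∧ e.samples.length ≤ m * e.mem.card) →
        ExpBound θ db (ts.foldlM (fun (r : Finset ℕ × List Entry) (t : ℝ) => do
          let C := ((ds.filter fun x => decide (t ≤ (x.2 : ℝ))).map Prod.fst).toFinset
          let e ← costEstimate P n B C t
          let e' ← costEstimate P n B r.1 0
          pure (if e.estimate P < e'.estimate P then C else r.1, r.2 ++ [e])) r)
          (0 + ts.length * (2 * c))
          (fun r => r.2.length ≤ H ∧ ∀ e ∈ r.2, e.mem ⊆ B ∧ e.samples.length ≤ m * e.mem.card)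
          fun _ => 0 := by
      intro ts
      induction ts with
      | nil => exact fun r _ h2 h3 => ExpBound.pure ⟨by simpa using h2, h3⟩ (by simp) hθ
      | cons t ts ih =>
        intro r h1 h2 h3
        rw [List.foldlM_cons]
        refine ExpBound.mono (w := (c + (c + 0)) + (0 + ts.length * (2 * c)))
          (ExpBound.bind_cost (Q := fun r => r.1 ⊆ B ∧ r.2.length + ts.length ≤ H ∧
            ∀ e ∈ r.2, e.mem ⊆ B ∧ e.samples.length ≤ m * e.mem.card) ?_ hθ (by positivity)
            fun r' hr' => ih r' hr'.1 hr'.2.1 hr'.2.2) hθ ?_ (fun _ h => h) fun _ _ => le_rfl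
        · refine (expBound_costEstimate h hn hnT (hC t) t).bind_cost hθ (by positivity)
            fun e he => ?_
          refine (expBound_costEstimate h hn hnT h1 0).bind_cost hθ le_rfl fun e' _ => ?_
          refine ExpBound.pure ⟨?_, ?_, ?_⟩ le_rfl hθ
          · dsimp only
            split_ifs
            exacts [hC t, h1]
          · simp only [List.length_append, List.length_cons, List.length_nil] at h2 ⊢
            omega
          · intro x hx
            rcases List.mem_append.1 hx with hx | hx
            · exact h3 x hx
            · rw [List.mem_singleton.1 hx]
              exact ⟨he.1 ▸ hC t, he.1.symm ▸ he.2⟩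
        · push_cast [List.length_cons]
          apply le_of_eq; ring
    refine (e2 (thresholds P n) (B, [e₀]) subset_rfl (by simpa [add_comm] using hlen)
      ?_).bind_cost hθ le_rfl fun r hr => ?_
    · intro e he
      rw [List.mem_singleton.1 he]
      exact ⟨he₀.1.subset, he₀.1.symm ▸ he₀.2⟩
    · exact ExpBound.pure hr le_rfl hθ
  -- At most H - 1 thresholds need two estimates each; the initial estimate fits into the remaining
  -- 2c.
  · have : (thresholds P n).length * (2 * c) ≤ (H - 1) * (2 * c) := by gcongr; linarith
    have e : (B.card : ℝ) * (1 + 2 * H * (2 + 2 * m)) = B.card + 2 * H * c := by rw [hc]; ring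
    rw [e]
    linarith

/-! ## Update-cluster -/

/-- A query is made with probability q ≤ 2/(|C| + 1). As exp θ ≤ 1 + 2θ for θ ≤ 1, its exponential
moment is at most 1 + 2qθ ≤ exp (2qθ), so it counts as 2q operations. -/
theorem expBound_resample (hθ : 0 ≤ θ) (hθ1 : θ ≤ 1) (C : Finset ℕ) (u : ℕ)
    (x : ℕ × ℕ × Bool) :
    ExpBound θ db (resample C u x) (4 / (C.card + 1)) (fun _ => True) fun _ => 0 := by
  unfold resample
  -- The potential of the coin is the cost of the branch that it selects.
  refine ExpBound.bind (Q := fun _ => True) (f := fun i => if i < 2 then 1 else 0)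
    (ExpBound.choose hθ (fun _ _ => trivial) (fun h => by simp at h) ?_) fun i _ => ?_
  · rw [Finset.card_range]
    have h1 : Real.exp θ ≤ 1 + 2 * θ := by
      have := Real.abs_exp_sub_one_le (x := θ) (by rwa [abs_of_nonneg hθ])
      rw [abs_of_nonneg hθ] at this
      linarith [(abs_le.1 this).2]
    have h2 : ∑ i ∈ Finset.range (C.card + 1), Real.exp (θ * if i < 2 then 1 else 0) ≤
        ∑ i ∈ Finset.range (C.card + 1), (1 + if i < 2 then 2 * θ else 0) := by
      refine Finset.sum_le_sum fun i _ => ?_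
      split_ifs
      · simpa using h1
      · simp
    have h3 : ∑ i ∈ Finset.range (C.card + 1), (1 + if i < 2 then 2 * θ else 0) ≤
        (C.card + 1) + 4 * θ := by
      rw [Finset.sum_add_distrib, ← Finset.sum_filter, Finset.sum_const, Finset.sum_const,
        Finset.card_range, nsmul_eq_mul, nsmul_eq_mul]
      have : ((Finset.range (C.card + 1)).filter fun i => i < 2).card ≤ 2 := by
        calc _ ≤ (Finset.range 2).card := Finset.card_le_card fun i hi => by
              simpa using (Finset.mem_filter.1 hi).2
          _ = 2 := Finset.card_range 2
      have : ((((Finset.range (C.card + 1)).filter fun i => i < 2).card : ℕ) : ℝ) ≤ 2 := by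
        exact_mod_cast this
      push_cast
      nlinarith
    refine h2.trans (h3.trans ?_)
    have hc : (0 : ℝ) < C.card + 1 := by positivity
    calc ((C.card : ℝ) + 1) + 4 * θ = (C.card + 1) * (θ * (4 / (C.card + 1)) + 1) := by
          field_simp; ring
      _ ≤ (C.card + 1) * Real.exp (θ * (4 / (C.card + 1))) := by
          gcongr; exact Real.add_one_le_exp _
      _ = _ := by push_cast; rfl
  · split_ifs with hi
    · refine (ExpBound.choose_cost hθ).bind_cost hθ zero_le_one (fun w _ => ?_) |>.mono hθ
        (by norm_num : (0 : ℝ) + 1 ≤ 1) (fun _ h => h) fun _ _ => le_rfl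
      refine (expBound_adjacent hθ u w).bind_cost hθ le_rfl (fun e _ => ?_) |>.mono hθ
        (by norm_num : (1 : ℝ) + 0 ≤ 1) (fun _ h => h) fun _ _ => le_rfl
      exact ExpBound.pure trivial le_rfl hθ
    · exact ExpBound.pure trivial le_rfl hθ

theorem Bounds.theta_le_one (h : Bounds P θ T m H s) : θ ≤ 1 := by
  have h1 := h.theta_le
  have h2 : (1 : ℝ) ≤ T := by exact_mod_cast h.one_le
  nlinarith [h.theta_nonneg]

/-- At most m|C| old samples at 4/(|C| + 1) each cost at most 4m in total, independently of |C|. The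
invariant survives because `u` is new to C: |C| grows by one and the samples by at most m. -/
theorem expBound_updateEntry (h : Bounds P θ T m H s) (hn : 1 ≤ n) (hnT : n ≤ T) {u : ℕ} (d : ℕ)
    {e : Entry} (hu : u ∉ e.mem) (he : e.samples.length ≤ m * e.mem.card) :
    ExpBound θ db (updateEntry P n u d e) (5 * m)
      (fun e' => e'.mem ⊆ insert u e.mem ∧ e'.samples.length ≤ m * e'.mem.card) fun _ => 0 := by
  have hθ := h.theta_nonneg
  have hceil : ⌈5 * Real.log n / P.eps ^ 3⌉₊ ≤ m := by
    simpa using h.ceil_card_samples_le hn hnT 1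
  have hceil' : ((⌈5 * Real.log n / P.eps ^ 3⌉₊ : ℕ) : ℝ) ≤ m := by exact_mod_cast hceil
  unfold updateEntry
  split_ifs
  · refine ExpBound.mono (w := 4 * m + (m + 0)) ?_ hθ (by linarith) (fun _ h => h)
      fun _ _ => le_rfl
    have e1 := ExpBound.forEach (db := db) hθ (by positivity) e.samples
      fun x _ => expBound_resample (db := db) hθ h.theta_le_one e.mem u x
    have hcost : (e.samples.length : ℝ) * (4 / (e.mem.card + 1)) ≤ 4 * m := by
      have : (e.samples.length : ℝ) ≤ m * e.mem.card := by exact_mod_cast he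
      rw [mul_div_assoc', div_le_iff₀ (by positivity)]
      nlinarith [(Nat.cast_nonneg m : (0 : ℝ) ≤ m)]
    refine (e1.mono hθ hcost (fun _ h => h) fun _ _ => le_rfl).bind_cost hθ (by positivity)
      fun old hold => ?_
    refine ((expBound_samplePairs hθ _ _).mono hθ hceil' (fun _ h => h)
      fun _ _ => le_rfl).bind_cost hθ le_rfl fun new hnew => ?_
    refine ExpBound.pure ⟨subset_rfl, ?_⟩ le_rfl hθ
    rw [List.length_append, Finset.card_insert_of_notMem hu, mul_add, mul_one, hold.1]
    exact add_le_add he (hnew.trans hceil)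
  · exact ExpBound.pure ⟨Finset.subset_insert _ _, he⟩ (by positivity) hθ

theorem expBound_updateCluster (h : Bounds P θ T m H s) (hn : 1 ≤ n) (hnT : n ≤ T) (u v : ℕ)
    {st : State} (hst : st.Inv G m H) :
    ExpBound θ db (updateCluster P n u v st) (1 + 5 * m * H)
      (fun st' => st'.pivot = st.pivot ∧ st'.Inv G m H) fun _ => 0 := by
  have hθ := h.theta_nonneg
  unfold updateCluster
  split_ifs with hu
  · exact ExpBound.pure ⟨rfl, hst⟩ (by positivity) hθ
  refine (expBound_degree hθ u).bind_cost hθ (by positivity) fun d _ => ?_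
  have hS := hst.store v
  have e1 := ExpBound.forEach (db := db) hθ (by positivity) (st.store v).entries
    fun e he => (expBound_updateEntry (db := db) h hn hnT d (fun hm => hu ((hS.2 e he).1 hm))
      (hS.2 e he).2).mono hθ le_rfl (Q' := fun e' => e'.mem ⊆ insert u (st.store v).base ∧
        e'.samples.length ≤ m * e'.mem.card)
      (fun e' he' => ⟨he'.1.trans (Finset.insert_subset_insert _ (hS.2 e he).1), he'.2⟩)
      fun _ _ => le_rfl
  have hcost : ((st.store v).entries.length : ℝ) * (5 * m) ≤ 5 * m * H := by
    have : ((st.store v).entries.length : ℝ) ≤ H := by exact_mod_cast hS.1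
    rw [mul_comm]; gcongr
  refine ((e1.mono hθ hcost (fun _ h => h) fun _ _ => le_rfl).bind_cost hθ le_rfl
    fun es hes => ?_).mono hθ (add_zero _).le (fun _ h => h) fun _ _ => le_rfl
  refine ExpBound.pure ⟨rfl, hst.adj, fun x => ?_⟩ le_rfl hθ
  by_cases hx : x = v
  · subst hx
    simp only [Function.update_self]
    exact ⟨hes.1.trans_le hS.1, hes.2⟩
  · simp only [Function.update_of_ne hx]
    exact hst.store x

end SparsePivot

namespace SparsePivot

variable {P : Params} {θ : ℝ} {T m H s n : ℕ} {G : SimpleGraph ℕ} {nodes : Finset ℕ}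

/-! ## Explore -/

open Classical in
/-- The number of nodes that are assigned to a pivot. -/
noncomputable def State.load (st : State) (nodes : Finset ℕ) : ℕ :=
  (nodes.filter fun z => ∃ v, st.pivot z = some v ∧ st.pivot v = some v).card

open Classical in
/-- The nodes that are assigned to a pivot other than `u`. -/
noncomputable def State.assignedElsewhere (st : State) (nodes : Finset ℕ) (u : ℕ) : Finset ℕ :=
  nodes.filter fun z => ∃ v, v ≠ u ∧ st.pivot z = some v ∧ st.pivot v = some v

theorem State.load_le (st : State) (nodes : Finset ℕ) (u : ℕ) :
    st.load nodes ≤ (st.assignedElsewhere nodes u).card + (st.assigned nodes u).card := by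
  classical
  refine le_trans (Finset.card_le_card ?_) (Finset.card_union_le _ _)
  intro z hz
  simp only [State.assignedElsewhere, State.assigned, Finset.mem_union, Finset.mem_filter] at hz ⊢
  obtain ⟨hz, v, h1, h2⟩ := hz
  by_cases hv : v = u
  · exact Or.inr ⟨hz, hv ▸ h1⟩
  · exact Or.inl ⟨hz, v, hv, h1, h2⟩

theorem State.card_assignedElsewhere_le (st : State) (nodes : Finset ℕ) (u : ℕ) :
    (st.assignedElsewhere nodes u).card ≤ st.load nodes := by
  classical
  refine Finset.card_le_card fun z hz => ?_
  simp only [State.assignedElsewhere, Finset.mem_filter] at hz ⊢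
  exact ⟨hz.1, hz.2.imp fun v h => h.2⟩

theorem State.Inv.card_assigned_le {st : State} (hst : st.Inv G m H) {u : ℕ} (hu : u ∈ nodes) :
    (st.assigned nodes u).card ≤ (Database.nbrs ⟨G, nodes⟩ u).card + 1 := by
  classical
  refine le_trans (Finset.card_le_card (t := insert u (Database.nbrs ⟨G, nodes⟩ u)) ?_)
    (Finset.card_insert_le _ _)
  intro z hz
  simp only [State.assigned, Database.nbrs, Finset.mem_filter, Finset.mem_insert] at hz ⊢
  exact (hst.adj z u hz.2).imp_right fun h => ⟨hz.1, hu, h⟩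

/-- When `u` becomes a pivot, every z with p(z) = u starts to count at once, so the load itself can
jump. The count away from `u` ignores these nodes; they lie in B_u, whose size is bounded by the
degree once Explore has ended. -/
theorem State.card_assignedElsewhere_setPivot_self (st : State) (nodes : Finset ℕ) (u : ℕ) :
    ((st.setPivot u (some u)).assignedElsewhere nodes u).card ≤ st.load nodes := by
  classical
  refine Finset.card_le_card fun z hz => ?_
  simp only [State.assignedElsewhere, Finset.mem_filter] at hz ⊢
  simp only [State.setPivot] at hz
  obtain ⟨hz, v, h1, h2, h3⟩ := hz
  rw [Function.update_of_ne h1] at h3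
  refine ⟨hz, v, ?_, h3⟩
  by_cases hzu : z = u
  · subst hzu
    rw [Function.update_self] at h2
    exact absurd (Option.some.inj h2).symm h1
  · rwa [Function.update_of_ne hzu] at h2

/-- As `u` does not become a pivot, no node assigned to `u` can start to count; only `u` itself can.
-/
theorem State.load_setPivot_le (st : State) (nodes : Finset ℕ) {u : ℕ} {x : Option ℕ}
    (hx : x ≠ some u) : (st.setPivot u x).load nodes ≤ st.load nodes + 1 := by
  classical
  refine le_trans (Finset.card_le_card (t := insert u (nodes.filter fun z =>
    ∃ v, st.pivot z = some v ∧ st.pivot v = some v)) fun z hz => ?_) (Finset.card_insert_le _ _)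
  simp only [Finset.mem_filter, Finset.mem_insert] at hz ⊢
  simp only [State.setPivot] at hz
  obtain ⟨hz, v, h2, h3⟩ := hz
  by_cases hzu : z = u
  · exact Or.inl hzu
  have hv : v ≠ u := by
    rintro rfl
    rw [Function.update_self] at h3
    exact hx h3
  rw [Function.update_of_ne hzu] at h2
  rw [Function.update_of_ne hv] at h3
  exact Or.inr ⟨hz, v, h2, h3⟩

theorem State.Inv.setPivot {st : State} (hst : st.Inv G m H) {u : ℕ} {x : Option ℕ}
    (hx : ∀ v, x = some v → u = v ∨ G.Adj v u) : (st.setPivot u x).Inv G m H := by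
  refine ⟨fun z v hz => ?_, hst.store⟩
  simp only [State.setPivot] at hz
  by_cases hzu : z = u
  · subst hzu
    rw [Function.update_self] at hz
    exact hx v hz
  · rw [Function.update_of_ne hzu] at hz
    exact hst.adj z v hz

/-- `s` arises from `st` by assigning some nodes of the closed neighbourhood of `u` to `u`. -/
def State.Captured (G : SimpleGraph ℕ) (u : ℕ) (st s : State) : Prop :=
  s.store = st.store ∧
    ∀ z, s.pivot z = st.pivot z ∨ s.pivot z = some u ∧ (z = u ∨ G.Adj u z)

theorem State.Captured.setPivot {u z : ℕ} {st s : State} (h : st.Captured G u s)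
    (hz : z = u ∨ G.Adj u z) : st.Captured G u (s.setPivot z (some u)) := by
  refine ⟨h.1, fun y => ?_⟩
  by_cases hy : y = z
  · subst hy
    exact Or.inr ⟨by simp [State.setPivot], hz⟩
  · simpa [State.setPivot, Function.update_of_ne hy] using h.2 y

theorem State.Captured.inv {u : ℕ} {st s : State} (h : st.Captured G u s) (hst : st.Inv G m H) :
    s.Inv G m H := by
  refine ⟨fun z v hz => ?_, fun v => by rw [h.1]; exact hst.store v⟩
  rcases h.2 z with h | ⟨h, h'⟩
  · exact hst.adj z v (h ▸ hz)
  · obtain rfl := Option.some.inj (h.symm.trans hz)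
    exact h'

theorem State.Captured.card_le {u : ℕ} {st s : State} (h : st.Captured G u s) :
    (s.assignedElsewhere nodes u).card ≤ (st.assignedElsewhere nodes u).card := by
  classical
  refine Finset.card_le_card fun z hz => ?_
  simp only [State.assignedElsewhere, Finset.mem_filter] at hz ⊢
  obtain ⟨hz, v, h1, h2, h3⟩ := hz
  have aux : ∀ y, s.pivot y = some v → st.pivot y = some v := fun y hy =>
    (h.2 y).elim (fun e => e ▸ hy) fun e => absurd (Option.some.inj (hy.symm.trans e.1)) h1
  exact ⟨hz, v, h1, aux z h2, aux v h3⟩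

/-- When the pivot `w` is captured, all nodes assigned to it stop being assigned elsewhere. -/
theorem State.Captured.card_add_le {u w : ℕ} {st s : State} (h : st.Captured G u s)
    (hw : st.pivot w = some w) (hwu : w ≠ u) (hs : s.pivot w = some u) :
    (s.assignedElsewhere nodes u).card + (st.assigned nodes w).card ≤
      (st.assignedElsewhere nodes u).card := by
  classical
  rw [← Finset.card_union_of_disjoint]
  · refine Finset.card_le_card (Finset.union_subset (fun z hz => ?_) fun z hz => ?_)
    · simp only [State.assignedElsewhere, Finset.mem_filter] at hz ⊢
      obtain ⟨hz, v, h1, h2, h3⟩ := hz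
      have aux : ∀ y, s.pivot y = some v → st.pivot y = some v := fun y hy =>
        (h.2 y).elim (fun e => e ▸ hy) fun e => absurd (Option.some.inj (hy.symm.trans e.1)) h1
      exact ⟨hz, v, h1, aux z h2, aux v h3⟩
    · simp only [State.assignedElsewhere, State.assigned, Finset.mem_filter] at hz ⊢
      exact ⟨hz.1, w, hwu, hz.2, hw⟩
  -- A node of the old B_w either moved to `u` or still points to `w`, which is no longer a pivot.
  · refine Finset.disjoint_left.2 fun z hz hz' => ?_
    simp only [State.assignedElsewhere, State.assigned, Finset.mem_filter] at hz hz'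
    obtain ⟨_, v, h1, h2, h3⟩ := hz
    rcases h.2 z with e | ⟨e, _⟩
    · rw [hz'.2] at e
      obtain rfl := Option.some.inj (h2.symm.trans e)
      exact h1 (Option.some.inj (h3.symm.trans hs))
    · exact h1 (Option.some.inj (h2.symm.trans e))

/-- Capturing a pivot w costs |B_w| adjacency queries, and the number of nodes assigned elsewhere
drops by at least |B_w|. Thus only the scan and the final size of B_u, at most d(u) + 1, remain to
be paid. -/
theorem expBound_explore (hθ : 0 ≤ θ) (hθT : 2 * θ * T ≤ 1)
    (rank : ℕ → unitInterval) {u : ℕ} (hu : u ∈ nodes)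
    (hd : (Database.nbrs ⟨G, nodes⟩ u).card ≤ T) {st : State} (hst : st.Inv G m H) :
    ExpBound θ ⟨G, nodes⟩ (explore nodes rank u st)
      ((st.assignedElsewhere nodes u).card +
        ((Database.nbrs ⟨G, nodes⟩ u).card + 1) * (2 * (1 + Real.log T) + 2))
      (fun st' => st'.Inv G m H) fun st' => st'.load nodes := by
  have hl := Real.log_natCast_nonneg T
  set d := (Database.nbrs ⟨G, nodes⟩ u).card with hd_def
  unfold explore
  refine ExpBound.mono (w := 1 + d * (2 * (1 + Real.log T)) +
    ((st.assignedElsewhere nodes u).card + (d + 1))) ?_ hθ ?_ (fun _ h => h) fun _ _ => le_rfl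
  · refine (expBound_scan hθ hθT u hd).bind_cost hθ (by positivity) ?_
    rintro nb rfl
    -- Each round has amortized cost 0. The framed d + 1 is kept for B_u, by which the final load
    -- may exceed the number of nodes assigned elsewhere.
    refine ((ExpBound.foldlM_const (R := fun st' : State => st'.Inv G m H)
      (g := fun st' => ((st'.assignedElsewhere nodes u).card : ℝ)) (c := 0) hθ le_rfl _
      ?_ st hst).frame hθ (c := (d : ℝ) + 1) (by positivity)).mono hθ (by simp) (fun _ h => h)
      fun st' h => ?_
    · intro w hw st hst
      have hwu : w = u ∨ G.Adj u w := by
        rw [Finset.mem_toList, Finset.mem_insert] at hw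
        refine hw.imp_right fun h => ?_
        simp only [Database.nbrs, Finset.mem_filter] at h
        exact h.2.2
      have h0 : st.Captured G u st := ⟨rfl, fun z => Or.inl rfl⟩
      split_ifs with h1 h2
      · have hwne : w ≠ u := fun e => by
          have := h1 w h2
          rw [e] at this
          exact lt_irrefl _ this
        refine ExpBound.mono (w := (st.assigned nodes w).card +
          (((st.assignedElsewhere nodes u).card : ℝ) - (st.assigned nodes w).card)) ?_ hθ
          (by linarith) (fun _ h => h) fun _ _ => le_rfl
        -- The potential left after paying |B_w| queries must be nonnegative; this follows from a
        -- hypothetical capture of `w` alone.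
        have hle : (st.assigned nodes w).card ≤ (st.assignedElsewhere nodes u).card := by
          have := (h0.setPivot hwu).card_add_le (nodes := nodes) h2 hwne (by simp [State.setPivot])
          omega
        have hle' : ((st.assigned nodes w).card : ℝ) ≤ (st.assignedElsewhere nodes u).card := by
          exact_mod_cast hle
        refine ExpBound.bind_cost (Q := fun s => st.Captured G u s) ?_ hθ (by linarith)
          fun s hs => ?_
        · refine (ExpBound.foldlM_const (R := fun s => st.Captured G u s) (g := fun _ => 0) (c := 1)
            hθ zero_le_one _ ?_ st h0).mono hθ (by simp) (fun _ h => h) fun _ _ => le_rfl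
          intro z _ s hs
          refine (expBound_adjacent hθ u z).bind_cost hθ le_rfl (fun e he => ?_) |>.mono hθ
            (by norm_num : (1 : ℝ) + 0 ≤ 0 + 1) (fun _ h => h) fun _ _ => le_rfl
          refine ExpBound.pure ?_ le_rfl hθ
          split_ifs with hee
          · refine hs.setPivot (Or.inr ?_)
            have := he hee
            simp only [Database.nbrs, Finset.mem_filter] at this
            exact this.2.2
          · exact hs
        · have hs' := hs.setPivot hwu
          refine ExpBound.pure (hs'.inv hst) ?_ hθ
          have := hs'.card_add_le (nodes := nodes) h2 hwne (by simp [State.setPivot])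
          have : (((s.setPivot w (some u)).assignedElsewhere nodes u).card : ℝ) +
            (st.assigned nodes w).card ≤ (st.assignedElsewhere nodes u).card := by
            exact_mod_cast this
          linarith
      · have hs' := h0.setPivot hwu
        have hc : (((st.setPivot w (some u)).assignedElsewhere nodes u).card : ℝ) ≤
            (st.assignedElsewhere nodes u).card := by exact_mod_cast hs'.card_le
        refine ExpBound.bind (Q := fun s => s = st)
          (f := fun _ => ((st.assignedElsewhere nodes u).card : ℝ)) ?_ ?_
        · exact ExpBound.pure rfl (by simp) hθ
        · rintro _ rfl
          exact ExpBound.pure (hs'.inv hst) hc hθ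
      · exact ExpBound.pure hst (by simp) hθ
    · have h2 := st'.load_le nodes u
      have h3 := h.card_assigned_le hu
      have : st'.load nodes ≤ (st'.assignedElsewhere nodes u).card + (d + 1) := by omega
      exact_mod_cast this
  · nlinarith

/-! ## Insertion -/

/-- The cost of one insertion, relative to (bound on the degrees) `+ 1`. -/
noncomputable def insertCost (T m H s : ℕ) : ℝ :=
  2 * (2 * (1 + Real.log T)) + 10 + 2 * s + 5 * H * (1 + m)

/-- `X` bounds every degree that passes the test with the rank of `u`. Both possible scans, of N(u)
and of N(v), are guarded by this test; without it only samples are drawn and at most one cluster is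
updated. -/
theorem expBound_insertNode (h : Bounds P θ T m H s) (hnT : nodes.card ≤ T)
    (rank : ℕ → unitInterval) {u : ℕ} (hu : u ∈ nodes) {X : ℝ} (hX0 : 0 ≤ X)
    (hX : ∀ d : ℕ, d ≤ T → (rank u : ℝ) * d ≤ P.lam * Real.log T → (d : ℝ) ≤ X)
    {st : State} (hst : st.Inv G m H) :
    ExpBound θ ⟨G, nodes⟩ (insertNode P nodes rank st u)
      (st.load nodes + insertCost T m H s * (X + 1))
      (fun st' => st'.Inv G m H) fun st' => st'.load nodes := by
  classical
  have hθ := h.theta_nonneg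
  have hl := Real.log_natCast_nonneg T
  have hn : 1 ≤ nodes.card := Finset.card_pos.2 ⟨u, hu⟩
  have hlog := log_natCast_le_log hn hnT
  have hL : P.L nodes.card ≤ P.lam * Real.log T := by
    have := h.lam_nonneg
    unfold Params.L; gcongr
  have hdT : ∀ v, (Database.nbrs ⟨G, nodes⟩ v).card ≤ T := fun v =>
    (Finset.card_le_card (Finset.filter_subset _ _)).trans hnT
  set h' := 2 * (1 + Real.log T) with hh'
  have hh0 : 0 ≤ h' := by positivity
  have hload : (0 : ℝ) ≤ st.load nodes := by positivity
  have hupd : ∀ (v : ℕ) (st₀ : State), st₀.Inv G m H →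
      ExpBound θ ⟨G, nodes⟩ (updateCluster P nodes.card u v st₀)
      (st₀.load nodes + (1 + 5 * m * H)) (fun st' => st'.pivot = st₀.pivot ∧ st'.Inv G m H)
      fun st' => st'.load nodes := by
    intro v st₀ hst₀
    refine ((expBound_updateCluster h hn hnT u v hst₀).frame hθ
      (c := (st₀.load nodes : ℝ)) (by positivity)).mono hθ (by linarith) (fun _ h => h)
      fun st' hst' => ?_
    simp [State.load, hst'.1]
  unfold insertNode
  set M := insertCost T m H s with hM
  have hMeq : M = 2 * h' + 10 + 2 * s + 5 * H * (1 + m) := rfl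
  have hmH : (0 : ℝ) ≤ m * H := by positivity
  have hH : (0 : ℝ) ≤ H := by positivity
  have hs0 : (0 : ℝ) ≤ s := by positivity
  refine ExpBound.mono (w := 1 + (st.load nodes + (M * (X + 1) - 1))) ?_ hθ (by linarith)
    (fun _ h => h) fun _ _ => le_rfl
  refine (expBound_degree hθ u).bind_cost hθ ?_ ?_
  · have : 1 ≤ M * (X + 1) := by
      have : 1 ≤ M := by rw [hMeq]; nlinarith
      nlinarith
    linarith
  rintro _ rfl
  set d := (Database.nbrs ⟨G, nodes⟩ u).card with hd
  by_cases hlow : (rank u : ℝ) * d ≤ P.L nodes.card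
  · rw [if_pos hlow]
    have hdX : (d : ℝ) ≤ X := hX d (hdT u) (hlow.trans hL)
    refine ExpBound.mono (w := 1 + d * h' +
      (st.load nodes + (M * (X + 1) - 2 - d * h'))) ?_ hθ (by linarith)
      (fun _ h => h) fun _ _ => le_rfl
    have hdh : (d : ℝ) * h' ≤ X * h' := by gcongr
    have hsX : (0 : ℝ) ≤ s * X := by positivity
    have hHX : (0 : ℝ) ≤ H * X := by positivity
    have hmHX : (0 : ℝ) ≤ m * H * X := by positivity
    have hXh : 0 ≤ X * h' := by positivity
    have hMX : M * (X + 1) = 2 * (X * h') + 10 * X + 2 * (s * X) + 5 * (H * X) + 5 * (m * H * X) +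
      (2 * h' + 10 + 2 * s + 5 * H + 5 * (m * H)) := by rw [hMeq]; ring
    refine (expBound_scan hθ h.theta_le u (hdT u)).bind_cost hθ (by linarith) ?_
    rintro nb rfl
    split
    · exact ExpBound.pure hst (by linarith) hθ
    · rename_i v hv
      have hv := List.argmin_mem hv
      rw [Finset.mem_toList, Finset.mem_insert] at hv
      split_ifs with hvu hpiv
      · have hst₁ : (st.setPivot u (some u)).Inv G m H :=
          hst.setPivot fun v hv => Or.inl (Option.some.inj hv)
        have hc : (((st.setPivot u (some u)).assignedElsewhere nodes u).card : ℝ) ≤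
            st.load nodes := by exact_mod_cast st.card_assignedElsewhere_setPivot_self nodes u
        set c : ℝ := (d + 1) * (1 + 2 * H * (2 + 2 * m)) with hc_def
        have hc0 : 0 ≤ c := by positivity
        have e1 := (expBound_explore hθ h.theta_le rank hu (hdT u) hst₁).frame hθ hc0
        refine ExpBound.mono (e1.bind (R := fun st' : State => st'.Inv G m H)
          (g := fun st' => st'.load nodes) fun st₁ hst₁ => ?_) hθ ?_ (fun _ h => h)
          fun _ _ => le_rfl
        · have hB : ((st₁.assigned nodes u).card : ℝ) ≤ d + 1 := by
            exact_mod_cast hst₁.card_assigned_le hu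
          refine ExpBound.mono (w := c + st₁.load nodes) ?_ hθ (by linarith)
            (fun _ h => h) fun _ _ => le_rfl
          refine ((expBound_breakCluster h hn hnT _).mono hθ (w' := c) (by rw [hc_def]; gcongr)
            (fun _ h => h) fun _ _ => le_rfl).bind_cost hθ (by positivity) fun r hr => ?_
          refine ExpBound.pure ⟨hst₁.adj, fun x => ?_⟩ le_rfl hθ
          by_cases hx : x = u
          · subst hx
            simpa only [Function.update_self] using hr
          · simpa only [Function.update_of_ne hx] using hst₁.store x
        · have h1 : (d : ℝ) * H ≤ H * X := by rw [mul_comm]; gcongr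
          have h2 : (d : ℝ) * (m * H) ≤ m * H * X := by rw [mul_comm]; gcongr
          rw [hMX, hc_def]
          linarith
      · have hvnb := hv.resolve_left hvu
        simp only [Database.nbrs, Finset.mem_filter] at hvnb
        have hst₁ : (st.setPivot u (some v)).Inv G m H :=
          hst.setPivot fun v' hv' => Or.inr (Option.some.inj hv' ▸ hvnb.2.2.symm)
        have hl1 : ((st.setPivot u (some v)).load nodes : ℝ) ≤ st.load nodes + 1 := by
          exact_mod_cast st.load_setPivot_le nodes fun e => hvu (Option.some.inj e)
        -- What remains for the degree of `v` and Explore. The last bracket is 1 for `u` joining the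
        -- load and 1 + 5mH for Update-cluster.
        set c : ℝ := M * (X + 1) - 2 - d * h' - (2 + 5 * m * H) with hc_def
        have hc : 1 + (X + 1) * (h' + 2) ≤ c := by
          rw [hc_def, hMX]
          linarith
        have hXh2 : 0 ≤ (X + 1) * (h' + 2) := by positivity
        have hc0 : 0 ≤ c := by linarith
        refine ExpBound.mono (((hupd v _ hst₁).frame hθ hc0).bind (R := fun st' : State => st'.Inv G m H)
          (g := fun st' => st'.load nodes) fun st₁ hst₁ => ?_) hθ ?_
          (fun _ h => h) fun _ _ => le_rfl
        · refine ExpBound.mono (w := 1 + (st₁.load nodes + (c - 1))) ?_ hθ (by linarith)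
            (fun _ h => h) fun _ _ => le_rfl
          have hl0 : (0 : ℝ) ≤ st₁.load nodes := by positivity
          refine (expBound_degree hθ v).bind_cost hθ (by linarith) ?_
          rintro _ rfl
          split_ifs with hlow'
          -- The degree of `v` is tested against the rank of `u`, so no second rank enters the
          -- bound.
          · have hdvX := hX _ (hdT v) (hlow'.trans hL)
            have hav : ((st₁.assignedElsewhere nodes v).card : ℝ) ≤ st₁.load nodes := by
              exact_mod_cast st₁.card_assignedElsewhere_le nodes v
            refine (expBound_explore hθ h.theta_le rank hvnb.1 (hdT v) hst₁.2).mono hθ ?_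
              (fun _ h => h) fun _ _ => le_rfl
            have : (((Database.nbrs ⟨G, nodes⟩ v).card : ℝ) + 1) * (h' + 2) ≤
              (X + 1) * (h' + 2) := by gcongr
            linarith
          · exact ExpBound.pure hst₁.2 (by linarith) hθ
        · rw [hc_def]
          linarith
      · have hvnb := hv.resolve_left hvu
        simp only [Database.nbrs, Finset.mem_filter] at hvnb
        have hl1 : ((st.setPivot u (some v)).load nodes : ℝ) ≤ st.load nodes + 1 := by
          exact_mod_cast st.load_setPivot_le nodes fun e => hvu (Option.some.inj e)
        refine ExpBound.pure (hst.setPivot fun v' hv' =>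
          Or.inr (Option.some.inj hv' ▸ hvnb.2.2.symm)) ?_ hθ
        linarith
  · rw [if_neg hlow]
    have hsc : ((⌈P.sig * Real.log nodes.card⌉₊ : ℕ) : ℝ) ≤ s := by
      have := h.sig_nonneg
      exact_mod_cast (Nat.ceil_mono (by gcongr)).trans h.neighbours
    have hMX : M ≤ M * (X + 1) := by
      have : 0 ≤ M := by rw [hMeq]; positivity
      nlinarith
    refine ExpBound.mono (w := s + (s + (st.load nodes + 1 + (1 + 5 * m * H)))) ?_ hθ
      (by linarith) (fun _ h => h) fun _ _ => le_rfl
    have e1 : ExpBound θ ⟨G, nodes⟩ (sampleClosed u d) 1 (fun _ => True) fun _ => 0 := by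
      unfold sampleClosed
      refine (ExpBound.choose_cost hθ).bind_cost hθ zero_le_one (fun i _ => ?_) |>.mono hθ
        (by norm_num : (0 : ℝ) + 1 ≤ 1) (fun _ h => h) fun _ _ => le_rfl
      split_ifs
      · exact ExpBound.pure trivial zero_le_one hθ
      · exact expBound_randomNeighbor hθ u
    refine ((e1.times hθ zero_le_one _).mono hθ (by simpa using hsc) (fun _ h => h)
      fun _ _ => le_rfl).bind_cost hθ (by positivity) fun S hS => ?_
    have e2 : ExpBound θ ⟨G, nodes⟩ (forEach (fun s =>
      match st.pivot s with
      | none => pure none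
      | some x => do
        let e ← adjacent x u
        pure (if e then some x else none)) S) s (fun cands => ∀ y ∈ cands, ∀ x, y = some x →
          G.Adj x u) fun _ => 0 := by
      refine (ExpBound.forEach (c := 1) (R := fun y => ∀ x, y = some x → G.Adj x u) hθ zero_le_one S
        fun x _ => ?_).mono hθ (by simpa [hS.1] using hsc) (fun _ h => h.2) fun _ _ => le_rfl
      split
      · exact ExpBound.pure (by simp) zero_le_one hθ
      · rename_i x _
        refine (expBound_adjacent hθ x u).bind_cost hθ le_rfl (fun e he => ?_) |>.mono hθ
          (by norm_num : (1 : ℝ) + 0 ≤ 1) (fun _ h => h) fun _ _ => le_rfl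
        refine ExpBound.pure ?_ le_rfl hθ
        intro y hy
        split_ifs at hy with hee
        · have := he hee
          simp only [Database.nbrs, Finset.mem_filter] at this
          exact Option.some.inj hy ▸ this.2.2
    refine e2.bind_cost hθ (by positivity) fun cands hcands => ?_
    have huncl : ExpBound θ ⟨G, nodes⟩ (pure (if ∃ x, x ≠ u ∧ st.pivot u = some x then st
        else st.setPivot u none) : DBM State) (st.load nodes + 1 + (1 + 5 * m * H))
        (fun st' => st'.Inv G m H) fun st' => st'.load nodes := by
      split_ifs
      · exact ExpBound.pure hst (by linarith) hθ
      · have hl1 : ((st.setPivot u none).load nodes : ℝ) ≤ st.load nodes + 1 := by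
          exact_mod_cast st.load_setPivot_le nodes (by simp)
        exact ExpBound.pure (hst.setPivot (by simp)) (by linarith) hθ
    rcases hv : (cands.filterMap id).argmin rank with _ | v
    · exact huncl
    · have hv := List.argmin_mem hv
      rw [List.mem_filterMap] at hv
      obtain ⟨y, hy, hyv⟩ := hv
      have hadj := hcands y hy v hyv
      dsimp only
      by_cases hr : rank v < rank u
      · rw [if_pos hr]
        have hvu : v ≠ u := fun e => by rw [e] at hr; exact lt_irrefl _ hr
        have hl1 : ((st.setPivot u (some v)).load nodes : ℝ) ≤ st.load nodes + 1 := by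
          exact_mod_cast st.load_setPivot_le nodes fun e => hvu (Option.some.inj e)
        have hst₁ : (st.setPivot u (some v)).Inv G m H :=
          hst.setPivot fun v' hv' => Or.inr (Option.some.inj hv' ▸ hadj)
        exact (hupd v _ hst₁).mono hθ (by linarith) (fun _ h => h.2) fun _ _ => le_rfl
      · rw [if_neg hr]
        exact huncl

end SparsePivot

namespace SparsePivot

variable {P : Params} {θ : ℝ} {T m H s : ℕ} {G : SimpleGraph ℕ} {db : Database}

/-! ## Sequences of updates -/

/-- The largest degree at most `T` that passes the test `π * d ≤ L` for a node of rank `π = x`. -/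
noncomputable def degreeCap (T : ℕ) (L : ℝ) (x : ℝ) : ℝ := if x = 0 then T else min T (L / x)

theorem degreeCap_nonneg {L x : ℝ} (hL : 0 ≤ L) (hx : 0 ≤ x) : 0 ≤ degreeCap T L x := by
  unfold degreeCap; split_ifs <;> positivity

theorem le_degreeCap {L x : ℝ} (hx : 0 ≤ x) {d : ℕ} (hd : d ≤ T) (h : x * d ≤ L) :
    (d : ℝ) ≤ degreeCap T L x := by
  have hd' : (d : ℝ) ≤ T := by exact_mod_cast hd
  unfold degreeCap
  split_ifs with h0
  · exact hd'
  · have : 0 < x := lt_of_le_of_ne hx (Ne.symm h0)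
    exact le_min hd' (by rw [le_div_iff₀ this]; linarith)

theorem insertCost_nonneg (T m H s : ℕ) : 0 ≤ insertCost T m H s := by
  have := Real.log_natCast_nonneg T
  unfold insertCost; positivity

/-- The bound for the cost of the insertion of a node of rank `x`. -/
noncomputable def rankCost (P : Params) (T m H s : ℕ) (x : unitInterval) : ℝ :=
  (insertCost T m H s + 1) * (degreeCap T (P.lam * Real.log T) x + 1)

theorem Bounds.degreeCap_nonneg (h : Bounds P θ T m H s) (x : unitInterval) :
    0 ≤ degreeCap T (P.lam * Real.log T) x :=
  SparsePivot.degreeCap_nonneg (mul_nonneg h.lam_nonneg (Real.log_natCast_nonneg T)) x.2.1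

/-- The leading 1 pays for the node's own place in the load: a recomputation starts with all nodes
as pivots, and an insertion enlarges the set on which the load is counted. -/
theorem Bounds.le_rankCost (h : Bounds P θ T m H s) (x : unitInterval) :
    1 + insertCost T m H s * (degreeCap T (P.lam * Real.log T) x + 1) ≤ rankCost P T m H s x := by
  have := h.degreeCap_nonneg x
  unfold rankCost
  linarith

theorem Bounds.rankCost_nonneg (h : Bounds P θ T m H s) (x : unitInterval) :
    0 ≤ rankCost P T m H s x := by
  have := h.degreeCap_nonneg x
  have := insertCost_nonneg T m H s
  unfold rankCost
  positivity

theorem expBound_recompute (h : Bounds P θ T m H s) (ranks : Ranks) (w : World)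
    (hw : w.nodes.card ≤ T) :
    ExpBound θ db (recompute P G ranks w)
      (∑ x ∈ w.nodes \ w.deleted, rankCost P T m H s (ranks (w.epoch + 1, x)))
      (fun w' => ∃ st : State, st.Inv G m H ∧
        w' = ⟨w.nodes \ w.deleted, ∅, w.epoch + 1, (w.nodes \ w.deleted).card, 0, st⟩)
      fun w' => w'.st.load w'.nodes := by
  classical
  have hθ := h.theta_nonneg
  unfold recompute
  set live := w.nodes \ w.deleted with hlive
  set start : State :=
    ⟨fun x => if x ∈ live then some x else none, fun _ => ∅, fun _ => ⟨∅, []⟩⟩ with hstart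
  have hlT : live.card ≤ T := (Finset.card_le_card Finset.sdiff_subset).trans hw
  have hinv : start.Inv G m H := by
    refine ⟨fun z v hz => Or.inl ?_, fun v => ⟨Nat.zero_le _, by simp [hstart]⟩⟩
    simp only [hstart] at hz
    split_ifs at hz
    exact Option.some.inj hz
  have hload : (start.load live : ℝ) ≤ live.card := by
    exact_mod_cast Finset.card_le_card (Finset.filter_subset _ _)
  have hcap : ∀ x, 0 ≤ degreeCap T (P.lam * Real.log T) (ranks (w.epoch + 1, x)) :=
    fun x => h.degreeCap_nonneg _
  have hfold := ExpBound.foldlM (db := ⟨G, live⟩)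
    (F := insertNode P live fun x => ranks (w.epoch + 1, x))
    (R := fun st : State => st.Inv G m H) (g := fun st => (st.load live : ℝ))
    (c := fun x => insertCost T m H s *
      (degreeCap T (P.lam * Real.log T) (ranks (w.epoch + 1, x)) + 1)) hθ
    (live.toList.insertionSort fun x y => ranks (w.epoch + 1, x) ≤ ranks (w.epoch + 1, y))
    (fun x _ => mul_nonneg (insertCost_nonneg T m H s) (by linarith [hcap x]))
    (fun x hx st hst => expBound_insertNode h hlT _
      (Finset.mem_toList.1 ((List.perm_insertionSort _ _).mem_iff.1 hx)) (hcap x)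
      (fun d hd hd' => le_degreeCap (ranks (w.epoch + 1, x)).2.1 hd hd') hst)
    start hinv
  refine ExpBound.bind ((hfold.onDatabase db).mono hθ ?_ (fun _ h => h) fun _ _ => le_rfl)
    fun st hst => ?_
  -- The order of insertion depends on the ranks, but the sum of the bounds does not depend on the
  -- order.
  · rw [((List.perm_insertionSort _ _).map _).sum_eq, Finset.sum_map_toList]
    calc _ ≤ (live.card : ℝ) + ∑ x ∈ live, insertCost T m H s *
          (degreeCap T (P.lam * Real.log T) (ranks (w.epoch + 1, x)) + 1) := by gcongr
      _ = ∑ x ∈ live, (1 + insertCost T m H s *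
          (degreeCap T (P.lam * Real.log T) (ranks (w.epoch + 1, x)) + 1)) := by
          simp [Finset.sum_add_distrib]
      _ ≤ _ := Finset.sum_le_sum fun x _ => h.le_rankCost _
  · exact ExpBound.pure ⟨st, hst, rfl⟩ le_rfl hθ

/-- The quantifiers matter: the new node sets and the charged ranks `S` are fixed before `ranks` and
the state, since no random choice influences the database. -/
theorem exists_expBound_applyUpdate (h : Bounds P θ T m H s) (upd : Update)
    (nodes deleted : Finset ℕ) (epoch n₀ count : ℕ) (hT : nodes.card + 1 ≤ T) :
    ∃ (nodes' deleted' : Finset ℕ) (S : Finset (ℕ × ℕ)), nodes ⊆ nodes' ∧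
      nodes'.card ≤ nodes.card + 1 ∧ S.card ≤ 1 ∧
      (∀ p ∈ S, p.1 = epoch ∧ p.2 ∉ nodes ∧ p.2 ∈ nodes') ∧
      ∀ (ranks : Ranks) (st : State), st.Inv G m H →
        ExpBound θ db (applyUpdate P G ranks ⟨nodes, deleted, epoch, n₀, count, st⟩ upd)
          (st.load nodes + ∑ p ∈ S, rankCost P T m H s (ranks p))
          (fun w' => ∃ st' : State, st'.Inv G m H ∧
            w' = ⟨nodes', deleted', epoch, n₀, count, st'⟩)
          fun w' => w'.st.load w'.nodes := by
  classical
  have hθ := h.theta_nonneg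
  rcases upd with x | x
  · by_cases hx : x ∈ nodes
    · refine ⟨nodes, deleted, ∅, subset_rfl, by omega, by simp, by simp, fun ranks st hst => ?_⟩
      simp only [applyUpdate, hx, if_true]
      exact ExpBound.pure ⟨st, hst, rfl⟩ (by simp) hθ
    · refine ⟨insert x nodes, deleted, {(epoch, x)}, Finset.subset_insert _ _,
        Finset.card_insert_le _ _, by simp, by simpa using hx, fun ranks st hst => ?_⟩
      simp only [applyUpdate, hx, if_false]
      have hcap := h.degreeCap_nonneg (ranks (epoch, x))
      have e1 := expBound_insertNode h ((Finset.card_insert_le x nodes).trans hT)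
        (fun y => ranks (epoch, y)) (Finset.mem_insert_self x nodes) hcap
        (fun d hd hd' => le_degreeCap (ranks (epoch, x)).2.1 hd hd') hst
      have hload : st.load (insert x nodes) ≤ st.load nodes + 1 := by
        unfold State.load
        rw [Finset.filter_insert]
        split_ifs
        · exact Finset.card_insert_le _ _
        · omega
      have hload' : (st.load (insert x nodes) : ℝ) ≤ st.load nodes + 1 := by exact_mod_cast hload
      refine ExpBound.bind ((e1.onDatabase db).mono hθ ?_ (fun _ h => h) fun _ _ => le_rfl)
        fun st' hst' => ?_
      · rw [Finset.sum_singleton]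
        linarith [h.le_rankCost (ranks (epoch, x))]
      · exact ExpBound.pure ⟨st', hst', rfl⟩ le_rfl hθ
  · by_cases hx : x ∈ nodes
    · refine ⟨nodes, insert x deleted, ∅, subset_rfl, by omega, by simp, by simp,
        fun ranks st hst => ?_⟩
      simp only [applyUpdate, hx, if_true]
      exact ExpBound.pure ⟨st, hst, rfl⟩ (by simp) hθ
    · refine ⟨nodes, deleted, ∅, subset_rfl, by omega, by simp, by simp, fun ranks st hst => ?_⟩
      simp only [applyUpdate, hx, if_false]
      exact ExpBound.pure ⟨st, hst, rfl⟩ (by simp) hθ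

/-- The rank of the node `p.2` in the epoch `p.1` has not been looked at before. -/
def Fresh (nodes : Finset ℕ) (epoch : ℕ) (p : ℕ × ℕ) : Prop :=
  epoch < p.1 ∨ p.1 = epoch ∧ p.2 ∉ nodes

/-- Each update since the last recomputation holds a credit of 6/ε + 1. A recomputation handles at
most n₀ + count + 1 nodes, and its trigger gives n₀ ≤ (6/ε)(count + 1), so the credit covers it; the
extra 1 is for the insertion itself. Soft-deleted nodes stay stored, so a node cannot be inserted
again, with the same rank, before they are purged. -/
theorem exists_expBound_step (h : Bounds P θ T m H s) (upd : Update)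
    (nodes deleted : Finset ℕ) (epoch n₀ count : ℕ) (hc : nodes.card ≤ n₀ + count)
    (hT : nodes.card + 1 ≤ T) :
    ∃ (nodes' deleted' : Finset ℕ) (epoch' n₀' count' : ℕ) (S : Finset (ℕ × ℕ)),
      nodes'.card ≤ n₀' + count' ∧ nodes'.card ≤ nodes.card + 1 ∧
      (∀ p ∈ S, Fresh nodes epoch p ∧ ¬ Fresh nodes' epoch' p) ∧
      (∀ p, Fresh nodes' epoch' p → Fresh nodes epoch p) ∧
      (S.card : ℝ) + (6 / P.eps + 1) * count' ≤ (6 / P.eps + 1) * (count + 1) + 1 ∧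
      ∀ (ranks : Ranks) (st : State), st.Inv G m H →
        ExpBound θ db (step P G ranks ⟨nodes, deleted, epoch, n₀, count, st⟩ upd)
          (st.load nodes + ∑ p ∈ S, rankCost P T m H s (ranks p))
          (fun w' => ∃ st' : State, st'.Inv G m H ∧
            w' = ⟨nodes', deleted', epoch', n₀', count', st'⟩)
          fun w' => w'.st.load w'.nodes := by
  classical
  have hθ := h.theta_nonneg
  have heps := h.eps_pos
  obtain ⟨nodes₁, deleted₁, S₁, hsub, hcard, hS₁, hS₁', hbound⟩ :=
    exists_expBound_applyUpdate (G := G) (db := db) h upd nodes deleted epoch n₀ count hT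
  have hS₁r : (S₁.card : ℝ) ≤ 1 := by exact_mod_cast hS₁
  by_cases hr : P.eps * n₀ / 6 ≤ ((count + 1 : ℕ) : ℝ)
  · set live := nodes₁ \ deleted₁ with hlive
    have hlive_card : live.card ≤ nodes₁.card := Finset.card_le_card Finset.sdiff_subset
    have hdisj : Disjoint S₁ (live.image fun x => (epoch + 1, x)) := by
      refine Finset.disjoint_left.2 fun p hp hp' => ?_
      obtain ⟨x, _, rfl⟩ := Finset.mem_image.1 hp'
      have := (hS₁' _ hp).1
      simp at this
    refine ⟨live, ∅, epoch + 1, live.card, 0, S₁ ∪ live.image fun x => (epoch + 1, x), le_rfl,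
      hlive_card.trans hcard, ?_, ?_, ?_, fun ranks st hst => ?_⟩
    · intro p hp
      rcases Finset.mem_union.1 hp with hp | hp
      · obtain ⟨h1, h2, _⟩ := hS₁' p hp
        refine ⟨Or.inr ⟨h1, h2⟩, ?_⟩
        rintro (h3 | ⟨h3, _⟩) <;> omega
      · obtain ⟨x, hx, rfl⟩ := Finset.mem_image.1 hp
        refine ⟨Or.inl (Nat.lt_succ_self _), ?_⟩
        rintro (h3 | ⟨_, h3⟩)
        · exact lt_irrefl _ h3
        · exact h3 hx
    · rintro p (h1 | ⟨h1, _⟩)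
      · exact Or.inl (by omega)
      · exact Or.inl (by omega)
    · have h1 : (S₁ ∪ live.image fun x => (epoch + 1, x)).card ≤ 1 + (n₀ + (count + 1)) := by
        refine (Finset.card_union_le _ _).trans (add_le_add hS₁ (Finset.card_image_le.trans ?_))
        omega
      have h2 : ((S₁ ∪ live.image fun x => (epoch + 1, x)).card : ℝ) ≤ 1 + (n₀ + (count + 1)) := by
        exact_mod_cast h1
      have h3 : (n₀ : ℝ) ≤ 6 / P.eps * (count + 1) := by
        push_cast at hr
        rw [div_mul_eq_mul_div, le_div_iff₀ heps]
        linarith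
      push_cast
      linarith
    · unfold step
      rw [Finset.sum_union hdisj, ← add_assoc]
      refine ExpBound.bind ((hbound ranks st hst).frame hθ
        (Finset.sum_nonneg fun p _ => h.rankCost_nonneg (ranks p))) ?_
      rintro _ ⟨st', hst', rfl⟩
      dsimp only
      rw [if_pos hr]
      refine (expBound_recompute (db := db) (G := G) h ranks
        ⟨nodes₁, deleted₁, epoch, n₀, count + 1, st'⟩ (hcard.trans hT)).mono hθ ?_
        (fun _ h => h) fun _ _ => le_rfl
      rw [Finset.sum_image fun x _ y _ hxy => by simpa using hxy]
      -- The load left by the old epoch is discarded; the new ranks pay for the new one.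
      exact le_add_of_nonneg_left (Nat.cast_nonneg _)
  · refine ⟨nodes₁, deleted₁, epoch, n₀, count + 1, S₁, by omega, hcard, ?_, ?_, ?_,
      fun ranks st hst => ?_⟩
    · intro p hp
      obtain ⟨h1, h2, h3⟩ := hS₁' p hp
      refine ⟨Or.inr ⟨h1, h2⟩, ?_⟩
      rintro (h4 | ⟨_, h4⟩)
      · omega
      · exact h4 h3
    · exact fun p => Or.imp_right fun h1 => ⟨h1.1, fun h2 => h1.2 (hsub h2)⟩
    · push_cast
      linarith
    · unfold step
      refine (hbound ranks st hst).bind ?_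
      rintro _ ⟨st', hst', rfl⟩
      dsimp only
      rw [if_neg hr]
      exact ExpBound.pure ⟨st', hst', rfl⟩ le_rfl hθ

/-- A rank charged in one step is no longer fresh afterwards, so the charged sets of different steps
are disjoint. -/
theorem exists_expBound_foldlM_step (h : Bounds P θ T m H s) (ups : List Update) :
    ∀ (nodes deleted : Finset ℕ) (epoch n₀ count : ℕ), nodes.card ≤ n₀ + count →
      nodes.card + ups.length ≤ T →
    ∃ S : Finset (ℕ × ℕ), (∀ p ∈ S, Fresh nodes epoch p) ∧
      (S.card : ℝ) ≤ (6 / P.eps + 1) * (count + ups.length) + ups.length ∧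
      ∀ (ranks : Ranks) (st : State), st.Inv G m H →
        ExpBound θ db (ups.foldlM (step P G ranks) ⟨nodes, deleted, epoch, n₀, count, st⟩)
          (st.load nodes + ∑ p ∈ S, rankCost P T m H s (ranks p)) (fun _ => True) fun _ => 0 := by
  classical
  have hθ := h.theta_nonneg
  have heps := h.eps_pos
  induction ups with
  | nil =>
    intro nodes deleted epoch n₀ count _ _
    refine ⟨∅, by simp, by simp; positivity, fun ranks st hst => ?_⟩
    exact ExpBound.pure trivial (by simp) hθ
  | cons upd ups ih =>
    intro nodes deleted epoch n₀ count hc hT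
    rw [List.length_cons] at hT
    obtain ⟨nodes', deleted', epoch', n₀', count', S₁, hc', hcard, hS₁, hfresh, hcount, hbound⟩ :=
      exists_expBound_step (G := G) (db := db) h upd nodes deleted epoch n₀ count hc (by omega)
    obtain ⟨S₂, hS₂, hcount₂, hbound₂⟩ := ih nodes' deleted' epoch' n₀' count' hc' (by omega)
    have hdisj : Disjoint S₁ S₂ :=
      Finset.disjoint_left.2 fun p hp hp' => (hS₁ p hp).2 (hS₂ p hp')
    refine ⟨S₁ ∪ S₂, ?_, ?_, fun ranks st hst => ?_⟩
    · intro p hp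
      rcases Finset.mem_union.1 hp with hp | hp
      exacts [(hS₁ p hp).1, hfresh p (hS₂ p hp)]
    · rw [Finset.card_union_of_disjoint hdisj]
      push_cast [List.length_cons]
      linarith
    · rw [List.foldlM_cons, Finset.sum_union hdisj, ← add_assoc]
      refine ExpBound.bind ((hbound ranks st hst).frame hθ
        (Finset.sum_nonneg fun p _ => h.rankCost_nonneg (ranks p))) ?_
      rintro _ ⟨st', hst', rfl⟩
      exact hbound₂ ranks st' hst'

/-- All updates together: every rank that is used is used for a single insertion. -/
theorem exists_process_none_le (h : Bounds P θ T m H s) (ups : List Update)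
    (hT : ups.length = T) :
    ∃ S : Finset (ℕ × ℕ), (S.card : ℝ) ≤ (6 / P.eps + 2) * T ∧ ∀ (ranks : Ranks) (b : ℕ),
      process P G ranks ups ⟨G, ∅⟩ b none ≤
        ENNReal.ofReal (Real.exp (θ * (∑ p ∈ S, rankCost P T m H s (ranks p) - b))) := by
  obtain ⟨S, -, hS, hbound⟩ := exists_expBound_foldlM_step (G := G) (db := ⟨G, ∅⟩) h ups ∅ ∅ 0 0 0
    (by simp) (by simp [hT])
  refine ⟨S, ?_, fun ranks b => ?_⟩
  · rw [hT] at hS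
    push_cast at hS
    linarith
  · have hinit : State.Inv G m H ⟨fun _ => none, fun _ => ∅, fun _ => ⟨∅, []⟩⟩ :=
      ⟨by simp, fun v => ⟨Nat.zero_le _, by simp⟩⟩
    have := ((hbound ranks _ hinit).onDatabase ⟨G, ∅⟩).prob_none_le b
    simpa [State.load, process, World.init] using this

end SparsePivot

namespace SparsePivot

variable {P : Params} {θ : ℝ} {T m H s : ℕ} {G : SimpleGraph ℕ}

/-! ## The exponential moments of the ranks -/

theorem measurable_degreeCap (T : ℕ) (L : ℝ) : Measurable (degreeCap T L) := by
  unfold degreeCap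
  exact Measurable.ite (measurableSet_singleton 0) measurable_const
    (measurable_const.min (measurable_const.div measurable_id))

/-- Split at 1/T: below, the cap T contributes at most 1; above, the integral of L/x is L log T. -/
theorem lintegral_degreeCap_le (hT : 1 ≤ T) {L : ℝ} (hL : 0 ≤ L) :
    ∫⁻ x : unitInterval, ENNReal.ofReal (degreeCap T L x) ≤
      ENNReal.ofReal (1 + L * Real.log T) := by
  have hT' : (1 : ℝ) ≤ T := by exact_mod_cast hT
  have hT0 : (0 : ℝ) < T := by linarith
  have hTi : (0 : ℝ) < 1 / T := by positivity
  have hTi1 : 1 / (T : ℝ) ≤ 1 := by rw [div_le_one hT0]; exact hT'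
  have hl := Real.log_natCast_nonneg T
  have e0 : ∫⁻ x : unitInterval, ENNReal.ofReal (degreeCap T L x) =
      ∫⁻ x in Set.Icc (0 : ℝ) 1, ENNReal.ofReal (degreeCap T L x) :=
    lintegral_subtype_comap measurableSet_Icc fun x => ENNReal.ofReal (degreeCap T L x)
  have hsub : Set.Icc (0 : ℝ) 1 ⊆ Set.Icc 0 (1 / (T : ℝ)) ∪ Set.Ioc (1 / (T : ℝ)) 1 := by
    intro x hx
    rcases le_or_gt x (1 / (T : ℝ)) with h | h
    exacts [Or.inl ⟨hx.1, h⟩, Or.inr ⟨h, hx.2⟩]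
  rw [e0]
  refine (lintegral_mono_set hsub).trans ((lintegral_union_le _ _ _).trans ?_)
  rw [ENNReal.ofReal_add zero_le_one (by positivity)]
  refine add_le_add ?_ ?_
  · calc _ ≤ ∫⁻ _ in Set.Icc (0 : ℝ) (1 / (T : ℝ)), ENNReal.ofReal T := by
          refine lintegral_mono fun x => ENNReal.ofReal_le_ofReal ?_
          unfold degreeCap
          split_ifs
          exacts [le_rfl, min_le_left _ _]
      _ = ENNReal.ofReal 1 := by
          rw [setLIntegral_const, Real.volume_Icc, ← ENNReal.ofReal_mul hT0.le]
          congr 1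
          field_simp
          ring
  · have hint : IntegrableOn (fun x : ℝ => L * (1 / x)) (Set.Ioc (1 / (T : ℝ)) 1) := by
      rw [← intervalIntegrable_iff_integrableOn_Ioc_of_le hTi1]
      refine (intervalIntegral.intervalIntegrable_one_div (fun x hx => ?_)
        continuousOn_id).const_mul L
      rw [Set.uIcc_of_le hTi1] at hx
      exact (hTi.trans_le hx.1).ne'
    calc _ ≤ ∫⁻ x in Set.Ioc (1 / (T : ℝ)) 1, ENNReal.ofReal (L * (1 / x)) := by
          refine setLIntegral_mono' measurableSet_Ioc fun x hx => ENNReal.ofReal_le_ofReal ?_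
          unfold degreeCap
          rw [if_neg (hTi.trans hx.1).ne', mul_one_div]
          exact min_le_right _ _
      _ = ENNReal.ofReal (∫ x in Set.Ioc (1 / (T : ℝ)) 1, L * (1 / x)) := by
          refine (ofReal_integral_eq_lintegral_ofReal hint ?_).symm
          filter_upwards [ae_restrict_mem measurableSet_Ioc] with x hx
          have := hTi.trans hx.1
          simp only [Pi.zero_apply]
          positivity
      _ = ENNReal.ofReal (L * Real.log T) := by
          rw [← intervalIntegral.integral_of_le hTi1, intervalIntegral.integral_const_mul,
            integral_one_div_of_pos hTi one_pos, one_div_one_div]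

/-- The truncation at T keeps z = cap/T in [0, 1], where exp z ≤ 1 + 2z. This reduces the
exponential moment to the first moment, and 1 + z ≤ exp z restores an exponential. -/
theorem lintegral_exp_degreeCap_le (hT : 1 ≤ T) {L : ℝ} (hL : 0 ≤ L) :
    ∫⁻ x : unitInterval, ENNReal.ofReal (Real.exp ((degreeCap T L x + 1) / T)) ≤
      ENNReal.ofReal (Real.exp ((1 + 2 * (1 + L * Real.log T)) / T)) := by
  have hT' : (1 : ℝ) ≤ T := by exact_mod_cast hT
  have hT0 : (0 : ℝ) < T := by linarith
  have hl := Real.log_natCast_nonneg T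
  have hmeas : Measurable fun x : unitInterval => degreeCap T L x :=
    (measurable_degreeCap T L).comp measurable_subtype_coe
  have hpt : ∀ x : unitInterval, ENNReal.ofReal (Real.exp ((degreeCap T L x + 1) / T)) ≤
      ENNReal.ofReal (Real.exp (1 / T)) *
        (1 + ENNReal.ofReal (2 / T) * ENNReal.ofReal (degreeCap T L x)) := by
    intro x
    have h0 := degreeCap_nonneg (T := T) hL x.2.1
    have h1 : degreeCap T L x ≤ T := by
      unfold degreeCap
      split_ifs
      exacts [le_rfl, min_le_left _ _]
    rw [← ENNReal.ofReal_mul (by positivity), ← ENNReal.ofReal_one,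
      ← ENNReal.ofReal_add zero_le_one (by positivity), ← ENNReal.ofReal_mul (by positivity)]
    refine ENNReal.ofReal_le_ofReal ?_
    rw [add_div, add_comm, Real.exp_add]
    gcongr
    have h2 : |degreeCap T L x / T| ≤ 1 := by
      rw [abs_of_nonneg (by positivity), div_le_one hT0]; exact h1
    have h3 := (abs_le.1 (Real.abs_exp_sub_one_le h2)).2
    rw [abs_of_nonneg (by positivity)] at h3
    have : 2 / (T : ℝ) * degreeCap T L x = 2 * (degreeCap T L x / T) := by ring
    linarith
  refine (lintegral_mono hpt).trans ?_
  have hm : Measurable fun x : unitInterval => ENNReal.ofReal (degreeCap T L x) :=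
    hmeas.ennreal_ofReal
  rw [lintegral_const_mul' _ _ ENNReal.ofReal_ne_top,
    lintegral_add_left measurable_const, lintegral_const_mul _ hm, lintegral_const, measure_univ,
    one_mul]
  calc _ ≤ ENNReal.ofReal (Real.exp (1 / T)) *
        (1 + ENNReal.ofReal (2 / T) * ENNReal.ofReal (1 + L * Real.log T)) := by
        gcongr
        exact lintegral_degreeCap_le hT hL
    _ ≤ _ := by
        rw [← ENNReal.ofReal_mul (by positivity), ← ENNReal.ofReal_one,
          ← ENNReal.ofReal_add zero_le_one (by positivity), ← ENNReal.ofReal_mul (by positivity)]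
        refine ENNReal.ofReal_le_ofReal ?_
        rw [add_div, Real.exp_add]
        gcongr
        have := Real.add_one_le_exp (2 * (1 + L * Real.log T) / T)
        have e : 2 / (T : ℝ) * (1 + L * Real.log T) = 2 * (1 + L * Real.log T) / T := by ring
        linarith

theorem lintegral_rankLaw_prod (S : Finset (ℕ × ℕ)) {F : unitInterval → ℝ≥0∞}
    (hF : Measurable F) :
    ∫⁻ ranks, ∏ p ∈ S, F (ranks p) ∂rankLaw = (∫⁻ x, F x) ^ S.card := by
  unfold rankLaw
  rw [ProbabilityTheory.lintegral_prod_eq_prod_lintegral_of_indepFun S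
    (fun p (ranks : Ranks) => F (ranks p))
    (ProbabilityTheory.iIndepFun_infinitePi (X := fun _ => F) fun _ => hF)
    fun p => hF.comp (measurable_pi_apply p)]
  rw [← Finset.prod_const]
  refine Finset.prod_congr rfl fun p _ => ?_
  exact (measurePreserving_eval_infinitePi (fun _ : ℕ × ℕ => (volume : Measure unitInterval))
    p).lintegral_comp hF

/-- Makes the average over update sequences a countable sum, hence measurable in the ranks and
interchangeable with the integral. -/
instance : Countable Update :=
  Function.Injective.countable (f := fun u : Update => match u with
    | .insert x => (Sum.inl x : ℕ ⊕ ℕ)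
    | .delete x => Sum.inr x) (by rintro (x | x) (y | y) h <;> simp_all)

theorem measurable_rankCost (P : Params) (T m H s : ℕ) : Measurable (rankCost P T m H s) := by
  unfold rankCost
  exact (((measurable_degreeCap T _).comp measurable_subtype_coe).add_const 1).const_mul _

/-- The choice of θ turns θ · `rankCost` into (cap + 1)/T, and as `S` does not depend on the ranks,
independence factors the integral over `S`. -/
theorem lintegral_exp_rankCost_le (h : Bounds P θ T m H s)
    (hθ : θ * (insertCost T m H s + 1) = 1 / T) (S : Finset (ℕ × ℕ)) (b : ℕ) :
    ∫⁻ ranks, ENNReal.ofReal (Real.exp (θ * (∑ p ∈ S, rankCost P T m H s (ranks p) - b)))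
      ∂rankLaw ≤
      ENNReal.ofReal (Real.exp (S.card *
        ((1 + 2 * (1 + P.lam * Real.log T * Real.log T)) / T) - θ * b)) := by
  have hL : 0 ≤ P.lam * Real.log T := mul_nonneg h.lam_nonneg (Real.log_natCast_nonneg T)
  set F : unitInterval → ℝ≥0∞ := fun x =>
    ENNReal.ofReal (Real.exp ((degreeCap T (P.lam * Real.log T) x + 1) / T)) with hF
  have hFm : Measurable F :=
    ((((measurable_degreeCap T _).comp measurable_subtype_coe).add_const 1).div_const
      _).exp.ennreal_ofReal
  have e : ∀ ranks : Ranks,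
      ENNReal.ofReal (Real.exp (θ * (∑ p ∈ S, rankCost P T m H s (ranks p) - b))) =
      ENNReal.ofReal (Real.exp (-(θ * b))) * ∏ p ∈ S, F (ranks p) := by
    intro ranks
    rw [hF, ← ENNReal.ofReal_prod_of_nonneg fun _ _ => Real.exp_nonneg _, ← Real.exp_sum,
      ← ENNReal.ofReal_mul (Real.exp_nonneg _), ← Real.exp_add]
    congr 2
    rw [mul_sub, Finset.mul_sum, sub_eq_neg_add]
    congr 1
    refine Finset.sum_congr rfl fun p _ => ?_
    rw [rankCost, ← mul_assoc, hθ]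
    ring
  simp only [e]
  rw [lintegral_const_mul' _ _ ENNReal.ofReal_ne_top, lintegral_rankLaw_prod S hFm]
  calc _ ≤ ENNReal.ofReal (Real.exp (-(θ * b))) * ENNReal.ofReal
        (Real.exp ((1 + 2 * (1 + P.lam * Real.log T * Real.log T)) / T)) ^ S.card := by
        gcongr
        exact lintegral_exp_degreeCap_le h.one_le hL
    _ = _ := by
        rw [← ENNReal.ofReal_pow (Real.exp_nonneg _), ← Real.exp_nat_mul,
          ← ENNReal.ofReal_mul (Real.exp_nonneg _), ← Real.exp_add]
        ring_nf

theorem exceedProb_le (h : Bounds P θ T m H s) (hθ : θ * (insertCost T m H s + 1) = 1 / T)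
    (U : PMF (List Update)) (hU : ∀ ups ∈ U.support, ups.length = T) (b : ℕ) :
    exceedProb P G U b ≤ ENNReal.ofReal (Real.exp ((6 / P.eps + 2) *
      (1 + 2 * (1 + P.lam * Real.log T * Real.log T)) - θ * b)) := by
  classical
  have hT0 : (0 : ℝ) < T := by exact_mod_cast h.one_le
  have hl := Real.log_natCast_nonneg T
  have hlam := h.lam_nonneg
  choose! S hS hbound using fun (ups : List Update) (hups : ups.length = T) =>
    exists_process_none_le (G := G) h ups hups
  set g : List Update → Ranks → ℝ≥0∞ := fun ups ranks => U ups *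
    ENNReal.ofReal (Real.exp (θ * (∑ p ∈ S ups, rankCost P T m H s (ranks p) - b))) with hg
  have hgm : ∀ ups, Measurable (g ups) := fun ups => by
    refine Measurable.const_mul (Measurable.ennreal_ofReal (Measurable.exp ?_)) _
    refine ((Finset.measurable_sum _ fun p _ => ?_).sub_const _).const_mul _
    exact (measurable_rankCost P T m H s).comp (measurable_pi_apply p)
  -- A measurable majorant of the failure probability suffices for the upper integral, so
  -- measurability of the algorithm in the ranks is never needed.
  refine (iInf₂_le_of_le (fun ranks => ∑' ups, g ups ranks)
    (Measurable.tsum hgm) (iInf_le_of_le ?_ le_rfl)).trans ?_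
  · intro ranks
    dsimp only
    rw [PMF.bind_apply]
    refine ENNReal.tsum_le_tsum fun ups => ?_
    by_cases hups : ups ∈ U.support
    · rw [hg]
      dsimp only
      gcongr
      exact hbound ups (hU ups hups) ranks b
    · rw [PMF.mem_support_iff, not_not] at hups
      simp [hups]
  · rw [lintegral_tsum fun ups => (hgm ups).aemeasurable]
    set R := ENNReal.ofReal (Real.exp ((6 / P.eps + 2) *
      (1 + 2 * (1 + P.lam * Real.log T * Real.log T)) - θ * b))
    calc _ ≤ ∑' ups, U ups * R := by
          refine ENNReal.tsum_le_tsum fun ups => ?_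
          by_cases hups : ups ∈ U.support
          · have hlen := hU ups hups
            rw [hg]
            dsimp only
            rw [lintegral_const_mul']
            · gcongr
              refine (lintegral_exp_rankCost_le h hθ (S ups) b).trans ?_
              refine ENNReal.ofReal_le_ofReal (Real.exp_le_exp.2 (sub_le_sub_right ?_ _))
              calc _ ≤ ((6 / P.eps + 2) * T) *
                    ((1 + 2 * (1 + P.lam * Real.log T * Real.log T)) / T) := by
                    gcongr
                    exact hS ups hlen
                _ = _ := by field_simp
            · exact U.apply_ne_top ups
          · rw [PMF.mem_support_iff, not_not] at hups
            simp [hg, hups]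
      _ = R := by rw [ENNReal.tsum_mul_right, U.tsum_coe, one_mul]

/-! ## The amortized running time -/

theorem insertCost_le_pow {A : ℝ} {a : ℕ} (hA : 0 ≤ A) {l y eps sig : ℝ} (hy : 1 ≤ y)
    (hl0 : 0 ≤ l) (hl : l ≤ y) (heps : 0 < eps) (heps1 : eps < 1) (hy2 : y = 2 * (l / eps))
    (hey : 1 / eps ≤ y) (hsig0 : 0 ≤ sig) (hsig : sig ≤ A * y ^ a) :
    2 * (2 * (1 + l)) + 10 + 2 * (⌈sig * l⌉₊ : ℝ) +
      5 * ((⌈l / Real.log (1 + eps)⌉₊ + 2 : ℕ) : ℝ) * (1 + (⌈10 * l / eps ^ 3⌉₊ : ℝ)) + 1 ≤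
      (261 + 2 * A) * y ^ (a + 5) := by
  have hy0 : 0 < y := by linarith
  have hs : (⌈sig * l⌉₊ : ℝ) ≤ A * y ^ (a + 1) + 1 := by
    refine (Nat.ceil_lt_add_one (by positivity)).le.trans ?_
    have : sig * l ≤ A * y ^ a * y := by gcongr
    rw [pow_succ]
    linarith
  have hlog : eps / 2 ≤ Real.log (1 + eps) := by
    have h1 := Real.one_sub_inv_le_log_of_pos (x := 1 + eps) (by linarith)
    have h2 : eps / 2 ≤ 1 - (1 + eps)⁻¹ := by
      have : 1 - (1 + eps)⁻¹ = eps / (1 + eps) := by field_simp; ring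
      rw [this]
      gcongr
      linarith
    linarith
  have hlog0 : 0 < Real.log (1 + eps) := by linarith
  have hH : ((⌈l / Real.log (1 + eps)⌉₊ + 2 : ℕ) : ℝ) ≤ 4 * y := by
    have h1 : l / Real.log (1 + eps) ≤ y := by
      calc _ ≤ l / (eps / 2) := by gcongr
        _ = y := by rw [hy2]; field_simp
    have h2 := (Nat.ceil_lt_add_one (a := l / Real.log (1 + eps)) (by positivity)).le
    push_cast
    linarith
  have hm : 1 + (⌈10 * l / eps ^ 3⌉₊ : ℝ) ≤ 12 * y ^ 4 := by
    have h1 : 10 * l / eps ^ 3 ≤ 10 * y ^ 4 := by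
      calc _ = 10 * (l * (1 / eps) ^ 3) := by field_simp
        _ ≤ 10 * (y * y ^ 3) := by gcongr
        _ = 10 * y ^ 4 := by ring
    have h2 := (Nat.ceil_lt_add_one (a := 10 * l / eps ^ 3) (by positivity)).le
    have h3 : 1 ≤ y ^ 4 := one_le_pow₀ hy
    linarith
  have hHm : 5 * ((⌈l / Real.log (1 + eps)⌉₊ + 2 : ℕ) : ℝ) * (1 + (⌈10 * l / eps ^ 3⌉₊ : ℝ)) ≤
      5 * (4 * y) * (12 * y ^ 4) := by gcongr
  have p1 : y ^ (a + 1) ≤ y ^ (a + 5) := pow_le_pow_right₀ hy (by omega)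
  have p2 : y ^ 5 ≤ y ^ (a + 5) := pow_le_pow_right₀ hy (by omega)
  have p3 : y ≤ y ^ (a + 5) := le_self_pow₀ hy (by omega)
  have p4 : A * y ^ (a + 1) ≤ A * y ^ (a + 5) := by gcongr
  have e5 : 5 * (4 * y) * (12 * y ^ 4) = 240 * y ^ 5 := by ring
  have : (261 + 2 * A) * y ^ (a + 5) = 261 * y ^ (a + 5) + 2 * (A * y ^ (a + 5)) := by ring
  -- The constant is 240 from the product, 4 from 4l, and 17 = 4 + 10 + 2 + 1 from the constant
  -- terms.
  linarith

theorem exponent_le_pow {A : ℝ} {a : ℕ} (hA : 0 ≤ A) {l y eps lam c : ℝ} (hy : 1 ≤ y)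
    (hl0 : 0 ≤ l) (hl : l ≤ y) (hey : 1 / eps ≤ y) (hlam0 : 0 ≤ lam)
    (hlam : lam ≤ A * y ^ a) :
    (6 / eps + 2) * (1 + 2 * (1 + lam * l * l)) + c * l ≤
      (24 + 16 * A + |c|) * y ^ (a + 3) := by
  have hy0 : 0 < y := by linarith
  have h1 : 6 / eps + 2 ≤ 8 * y := by
    have : 6 / eps = 6 * (1 / eps) := by ring
    linarith
  have h2 : lam * l * l ≤ A * y ^ (a + 2) := by
    calc _ ≤ A * y ^ a * y * y := by gcongr
      _ = _ := by ring
  have h3 : c * l ≤ |c| * y ^ (a + 3) := by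
    calc c * l ≤ |c| * l := by gcongr; exact le_abs_self c
      _ ≤ |c| * y ^ (a + 3) := by
        gcongr
        exact hl.trans (le_self_pow₀ hy (by omega))
  have h4 : (1 : ℝ) ≤ y ^ (a + 2) := one_le_pow₀ hy
  have h5 : 1 + 2 * (1 + lam * l * l) ≤ 3 * y ^ (a + 2) + 2 * (A * y ^ (a + 2)) := by linarith
  calc _ ≤ 8 * y * (3 * y ^ (a + 2) + 2 * (A * y ^ (a + 2))) + |c| * y ^ (a + 3) := by gcongr
    _ = _ := by ring

end SparsePivot

/-! ### Choice of the parameters and conclusion -/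

theorem theorem2 (a : ℕ) :
    ∃ k : ℕ, ∀ A c : ℝ, ∃ K : ℝ, 0 < K ∧
      ∀ P : SparsePivot.Params, 0 < P.eps → P.eps < 1 →
        0 ≤ P.lam → P.lam ≤ A * (1 / P.eps) ^ a →
        0 ≤ P.sig → P.sig ≤ A * (1 / P.eps) ^ a →
      ∀ (G : SimpleGraph ℕ) (T : ℕ), 2 ≤ T →
      ∀ U : PMF (List SparsePivot.Update), (∀ ups ∈ U.support, ups.length = T) →
      ∀ b : ℕ, (T : ℝ) * (K * (Real.log T * (1 / P.eps)) ^ k) ≤ (b : ℝ) →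
        SparsePivot.exceedProb P G U b ≤ ENNReal.ofReal ((T : ℝ) ^ (-c)) := by
  -- The exponent is (a + 5) + (a + 3), from `insertCost_le_pow` and `exponent_le_pow`; the power of
  -- 2 comes from y = 2 log T / ε.
  refine ⟨2 * a + 8, fun A c => ⟨2 ^ (2 * a + 8) * ((261 + 2 * |A|) * (24 + 16 * |A| + |c|)),
    by positivity, ?_⟩⟩
  intro P heps heps1 hlam0 hlam hsig0 hsig G T hT U hU b hb
  set l := Real.log T with hl
  have hT0 : (0 : ℝ) < T := by positivity
  have hl2 : 1 / 2 ≤ l := by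
    have h1 : Real.log 2 ≤ l := Real.log_le_log (by norm_num) (by exact_mod_cast hT)
    linarith [Real.log_two_gt_d9]
  have hl0 : 0 ≤ l := by linarith
  -- The factor 2 ensures 1/ε ≤ y although log 2 < 1, and l / log(1 + ε) ≤ y because log(1 + ε) ≥
  -- ε/2.
  set y := 2 * (l / P.eps) with hy
  have hle : l ≤ l / P.eps := le_div_self hl0 heps heps1.le
  have hy1 : 1 ≤ y := by linarith
  have hly : l ≤ y := by linarith
  have hey : 1 / P.eps ≤ y := by
    rw [hy, ← mul_div_assoc]
    gcongr
    linarith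
  have hpow : A * (1 / P.eps) ^ a ≤ |A| * y ^ a := by
    gcongr
    exact le_abs_self A
  set m := ⌈10 * l / P.eps ^ 3⌉₊ with hm
  set H := ⌈l / Real.log (1 + P.eps)⌉₊ + 2 with hH
  set s := ⌈P.sig * l⌉₊ with hs
  have hN0 := SparsePivot.insertCost_nonneg T m H s
  have hNle : SparsePivot.insertCost T m H s + 1 ≤ (261 + 2 * |A|) * y ^ (a + 5) :=
    SparsePivot.insertCost_le_pow (abs_nonneg A) hy1 hl0 hly heps heps1 hy hey hsig0
      (hsig.trans hpow)
  have hN2 : 2 ≤ SparsePivot.insertCost T m H s + 1 := by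
    have : (0 : ℝ) ≤ 2 * (2 * (1 + Real.log T)) + 2 * s + 5 * H * (1 + m) := by positivity
    unfold SparsePivot.insertCost
    linarith
  set N := SparsePivot.insertCost T m H s + 1 with hN
  -- θ = 1/(NT) normalizes the rank costs, and N ≥ 2 makes it small enough for the coupon collector.
  have hbounds : SparsePivot.Bounds P (1 / (N * T)) T m H s :=
    { theta_nonneg := by positivity
      theta_le := by
        have : 2 * (1 / (N * T)) * (T : ℝ) = 2 / N := by field_simp
        rw [this, div_le_one (by linarith)]
        exact hN2
      one_le := by omega
      eps_pos := heps
      lam_nonneg := hlam0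
      sig_nonneg := hsig0
      samples := Nat.le_ceil _
      candidates := le_rfl
      neighbours := le_rfl }
  have hNpos : 0 < N := by linarith
  refine (SparsePivot.exceedProb_le (G := G) hbounds (by rw [← hN]; field_simp) U hU b).trans ?_
  rw [Real.rpow_def_of_pos hT0, ← hl]
  refine ENNReal.ofReal_le_ofReal (Real.exp_le_exp.2 ?_)
  have hexp := SparsePivot.exponent_le_pow (c := c) (abs_nonneg A) hy1 hl0 hly hey hlam0
    (hlam.trans hpow)
  -- As T^(-c) = exp(-c l), it suffices that θb dominates the exponent plus c l.
  have hkey : (24 + 16 * |A| + |c|) * y ^ (a + 3) ≤ 1 / (N * T) * b := by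
    rw [one_div_mul_eq_div, le_div_iff₀ (by positivity)]
    refine le_trans ?_ hb
    have hy' : 2 ^ (2 * a + 8) * (l * (1 / P.eps)) ^ (2 * a + 8) = y ^ (a + 3) * y ^ (a + 5) := by
      rw [← mul_pow, ← pow_add, hy]
      congr 1
      · ring
      · ring
    calc (24 + 16 * |A| + |c|) * y ^ (a + 3) * (N * T)
        ≤ (24 + 16 * |A| + |c|) * y ^ (a + 3) * ((261 + 2 * |A|) * y ^ (a + 5) * T) := by gcongr
      _ = T * ((261 + 2 * |A|) * (24 + 16 * |A| + |c|) * (y ^ (a + 3) * y ^ (a + 5))) := by ring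
      _ = _ := by rw [← hy']; ring
  linarith
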